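/- For a commutative unital ring $R$ and $n\ge 0$, let $\mathfrak{sol}_n(R)$ be the Lie $R$-algebra of all upper triangular $n\times n$ matrices over $R$, with bracket $[a,b]=ab-ba$. For a Lie $R$-algebra $\mathfrak g$ let $H_k(\mathfrak g;R)$ be the homology of the Chevalley complex with $k$-th module $\Lambda^k_R\mathfrak g$ and boundary $\partial(x_1\wedge\dots\wedge x_k)=\sum_{r<s}(-1)^{r+s}[x_r,x_s]\wedge x_1\wedge\dots\widehat{x_r}\dots\widehat{x_s}\dots\wedge x_k$, and let $H^k(\mathfrak g;R)$ be the cohomology of the dual complex $\mathrm{Hom}_R(\Lambda^k_R\mathfrak g,R)$. Write $H_k(\mathfrak{sol}_n;R)$ and $H^k(\mathfrak{sol}_n;R)$ for $\mathfrak g=\mathfrak{sol}_n(R)$. A binomial coefficient $\binom{a}{b}$ is $0$ if $a<0$ or $b<0$. Let $p$ be a prime. (1) Let $R$ be any commutative ring of characteristic $p$ (i.e. $\mathbb F_p\le R$). If $n=p+1$, then for all $k\ge 0$, as $R$-modules, $$H_k(\mathfrak{sol}_n;R)\cong H^k(\mathfrak{sol}_n;R)\cong R^{\binom{n}{k}}\oplus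 R^{\binom{n}{k-2n+3}}.$$ If $k=2p-1$, then for all $n\ge 0$, as $R$-modules, $$H_k(\mathfrak{sol}_n;R)\cong R^{\binom{n}{k}}\oplus R^{\binom{n-p+1}{2}}.$$ (2) Consider the table of the groups $H_k(\mathfrak{sol}_n;\mathbb Z)$, with columns indexed by $n$ and rows by $k$. The first column that contains a group with $p$-torsion is $n=p+1$, and the first row that contains a group with $p$-torsion is $k=2p-1$. Likewise, $n=p+1$ is the first column and $k=2p-1$ is the first row in which some $\mathbb Z/p^l$ with $l\ge 1$ appears as a direct summand; moreover, the entry $H_{2p-1}(\mathfrak{sol}_{p+1};\mathbb Z)$ itself has such a summand. -/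

import Mathlib

noncomputable section

namespace ChevalleyEilenberg

section KerModRange

variable {R A B C : Type*} [CommRing R] [AddCommGroup A] [Module R A]
  [AddCommGroup B] [Module R B] [AddCommGroup C] [Module R C]

/-- The homology at `B` of a complex `A → B → C`, i.e. `ker g / im f`. -/
def KerModRange (f : A →ₗ[R] B) (g : B →ₗ[R] C) : Type _ :=
  LinearMap.ker g ⧸ (LinearMap.range f).submoduleOf (LinearMap.ker g)

instance (f : A →ₗ[R] B) (g : B →ₗ[R] C) : AddCommGroup (KerModRange f g) :=
  inferInstanceAs
    (AddCommGroup (LinearMap.ker g ⧸ (LinearMap.range f).submoduleOf (LinearMap.ker g)))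

instance (f : A →ₗ[R] B) (g : B →ₗ[R] C) : Module R (KerModRange f g) :=
  inferInstanceAs
    (Module R (LinearMap.ker g ⧸ (LinearMap.range f).submoduleOf (LinearMap.ker g)))

end KerModRange

section Boundary

variable (R : Type*) [CommRing R] (L : Type*) [LieRing L] [LieAlgebra R L]

/-- For `v = (v 0, …, v (k+1))`, the wedge product
`⁅v r, v s⁆ ∧ v 0 ∧ … (omitting v r and v s) … ∧ v (k+1)`, where `r = s.succAbove t`
(that is, `r` is the position in `v` of the `t`-th entry left after removing the `s`-th one). -/
def bracketWedge {k : ℕ} (v : Fin (k + 2) → L) (s : Fin (k + 2)) (t : Fin (k + 1)) :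
    ⋀[R]^(k + 1) L :=
  exteriorPower.ιMulti R (k + 1)
    (Matrix.vecCons ⁅v (s.succAbove t), v s⁆ (t.removeNth (s.removeNth v)))

variable {R L}

theorem bracketWedge_update_add {k : ℕ} (v : Fin (k + 2) → L) (s : Fin (k + 2)) (t : Fin (k + 1))
    (i : Fin (k + 2)) (x y : L) :
    bracketWedge R L (Function.update v i (x + y)) s t =
      bracketWedge R L (Function.update v i x) s t +
        bracketWedge R L (Function.update v i y) s t := by
  unfold bracketWedge
  rcases eq_or_ne i s with rfl | hi
  · simp [Fin.succAbove_ne, AlternatingMap.map_vecCons_add]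
  · obtain ⟨j, rfl⟩ := Fin.exists_succAbove_eq hi
    rcases eq_or_ne j t with rfl | hj
    · simp [Fin.ne_succAbove, AlternatingMap.map_vecCons_add]
    · obtain ⟨l, rfl⟩ := Fin.exists_succAbove_eq hj
      simp [Fin.ne_succAbove, (Fin.succAbove_right_injective (p := s)).ne hj.symm,
        Matrix.vecCons, Fin.cons_update]

theorem bracketWedge_update_smul {k : ℕ} (v : Fin (k + 2) → L) (s : Fin (k + 2)) (t : Fin (k + 1))
    (i : Fin (k + 2)) (c : R) (x : L) :
    bracketWedge R L (Function.update v i (c • x)) s t =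
      c • bracketWedge R L (Function.update v i x) s t := by
  unfold bracketWedge
  rcases eq_or_ne i s with rfl | hi
  · simp [Fin.succAbove_ne, AlternatingMap.map_vecCons_smul]
  · obtain ⟨j, rfl⟩ := Fin.exists_succAbove_eq hi
    rcases eq_or_ne j t with rfl | hj
    · simp [Fin.ne_succAbove, AlternatingMap.map_vecCons_smul]
    · obtain ⟨l, rfl⟩ := Fin.exists_succAbove_eq hj
      simp [Fin.ne_succAbove, (Fin.succAbove_right_injective (p := s)).ne hj.symm,
        Matrix.vecCons, Fin.cons_update]

/-- Exchanging the roles of the two removed entries changes the sign of the bracket and the sign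
`(-1) ^ (s + t)`, hence not their product. -/
theorem neg_one_pow_smul_bracketWedge_swap {k : ℕ} (v : Fin (k + 2) → L) (s : Fin (k + 2))
    (t : Fin (k + 1)) :
    (-1 : ℤ) ^ ((s.succAbove t : ℕ) + (t.predAbove s : ℕ)) •
        bracketWedge R L v (s.succAbove t) (t.predAbove s) =
      (-1 : ℤ) ^ ((s : ℕ) + (t : ℕ)) • bracketWedge R L v s t := by
  rw [Fin.neg_one_pow_succAbove_add_predAbove]
  unfold bracketWedge
  rw [Fin.succAbove_succAbove_predAbove, Fin.removeNth_removeNth_eq_swap v t s,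
    ← lie_skew (v s) (v (s.succAbove t))]
  set f := exteriorPower.ιMulti R (k + 1) (M := L)
  have h : ∀ (x : L) (w : Fin k → L),
      f (Matrix.vecCons (-x) w) = - f (Matrix.vecCons x w) := by
    intro x w
    have := f.map_vecCons_smul w (-1 : R) x
    simpa using this
  rw [h]
  simp

theorem sum_bracketWedge_eq_zero {k : ℕ} (v : Fin (k + 2) → L) (i j : Fin (k + 2))
    (hv : v i = v j) (hij : i ≠ j) :
    ∑ s : Fin (k + 2), ∑ t : Fin (k + 1),
      (if t.castSucc < s then (-1 : ℤ) ^ ((s : ℕ) + (t : ℕ)) • bracketWedge R L v s t else 0) =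
      0 := by
  classical
  let F : Fin (k + 2) → Fin (k + 1) → ⋀[R]^(k + 1) L := fun s t =>
    (-1 : ℤ) ^ ((s : ℕ) + (t : ℕ)) • bracketWedge R L v s t
  let P : Fin (k + 2) → Fin (k + 2) → ⋀[R]^(k + 1) L := fun a b =>
    ∑ t, if b.succAbove t = a then F b t else 0
  have hPF : ∀ s t, P (s.succAbove t) s = F s t := by
    intro s t
    simp only [P, Fin.succAbove_right_inj]
    simp
  have hPd : ∀ a, P a a = 0 := fun a => by simp [P, Fin.succAbove_ne]
  have hPs : ∀ a b, P a b = P b a := by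
    intro a b
    rcases eq_or_ne a b with rfl | h
    · rfl
    · obtain ⟨t, rfl⟩ := Fin.exists_succAbove_eq h
      have h1 := hPF (b.succAbove t) (t.predAbove b)
      rw [Fin.succAbove_succAbove_predAbove] at h1
      rw [hPF, h1]
      exact (neg_one_pow_smul_bracketWedge_swap v b t).symm
  have hP0 : ∀ a b, a ≠ i → a ≠ j → b ≠ i → b ≠ j → P a b = 0 := by
    intro a b hai haj hbi hbj
    rcases eq_or_ne a b with rfl | h
    · exact hPd a
    · obtain ⟨t, rfl⟩ := Fin.exists_succAbove_eq h
      obtain ⟨i', rfl⟩ := Fin.exists_succAbove_eq hbi.symm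
      obtain ⟨j', rfl⟩ := Fin.exists_succAbove_eq hbj.symm
      have hi' : i' ≠ t := fun h => hai (by rw [h])
      have hj' : j' ≠ t := fun h => haj (by rw [h])
      obtain ⟨i'', rfl⟩ := Fin.exists_succAbove_eq hi'
      obtain ⟨j'', rfl⟩ := Fin.exists_succAbove_eq hj'
      rw [hPF]
      simp only [F, bracketWedge]
      rw [AlternatingMap.map_eq_zero_of_eq _ _ (i := Fin.succ i'') (j := Fin.succ j''), smul_zero]
      · simpa [Fin.removeNth] using hv
      · intro h
        exact hij (by rw [Fin.succ_injective _ h])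
  have hPij : P i j = 0 := by
    obtain ⟨t, rfl⟩ := Fin.exists_succAbove_eq hij
    rw [hPF]
    simp only [F, bracketWedge]
    rw [hv, lie_self, AlternatingMap.map_coord_zero _ (0 : Fin (k + 1)) (by simp), smul_zero]
  have hPc : ∀ s, s ≠ i → s ≠ j → P i s + P j s = 0 := by
    intro s hi hj
    obtain ⟨i', rfl⟩ := Fin.exists_succAbove_eq hi.symm
    obtain ⟨j', rfl⟩ := Fin.exists_succAbove_eq hj.symm
    have hij' : i' ≠ j' := fun h => hij (by rw [h])
    have key := AlternatingMap.neg_one_pow_smul_map_removeNth_add_eq_zero_of_eq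
      ((exteriorPower.ιMulti R (k + 1) (M := L)).curryLeft ⁅v (s.succAbove i'), v s⁆)
      (v := s.removeNth v) (i := i') (j := j') hv hij'
    rw [hPF, hPF]
    simp only [F, bracketWedge, pow_add, mul_smul, ← smul_add]
    rw [← hv]
    simp only [AlternatingMap.curryLeft_apply_apply] at key
    rw [key, smul_zero]
  -- rewrite the sum as a sum over pairs `a < b`
  have hsum : ∀ s : Fin (k + 2), ∑ t : Fin (k + 1), (if t.castSucc < s then F s t else 0) =
      ∑ a : Fin (k + 2), if a < s then P a s else 0 := by
    intro s
    rw [Fin.sum_univ_succAbove _ s]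
    simp only [lt_self_iff_false, if_false, zero_add, hPF, Fin.succAbove_lt_iff_castSucc_lt]
  change ∑ s : Fin (k + 2), ∑ t : Fin (k + 1), (if t.castSucc < s then F s t else 0) = 0
  simp only [hsum]
  rw [← Finset.sum_product' Finset.univ Finset.univ
    (fun s a => if a < s then P a s else 0), ← Finset.sum_filter]
  let σ := Equiv.swap i j
  have hσ : ∀ a b, P a b + P (σ a) (σ b) = 0 := by
    intro a b
    by_cases hai : a = i
    · subst hai
      by_cases hbi : b = a
      · subst hbi; simp [hPd]
      by_cases hbj : b = j
      · subst hbj; simp [σ, hPij, hPs b a]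
      · simpa [σ, Equiv.swap_apply_of_ne_of_ne hbi hbj] using hPc b hbi hbj
    by_cases haj : a = j
    · subst haj
      by_cases hbj : b = a
      · subst hbj; simp [hPd]
      by_cases hbi : b = i
      · subst hbi; simp [σ, hPij, hPs a b]
      · simpa [σ, Equiv.swap_apply_of_ne_of_ne hbi hbj, add_comm] using hPc b hbi hbj
    have ha : σ a = a := Equiv.swap_apply_of_ne_of_ne hai haj
    rw [ha]
    by_cases hbi : b = i
    · subst hbi
      rw [hPs a b, hPs a (σ b)]
      simpa [σ] using hPc a hai haj
    by_cases hbj : b = j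
    · subst hbj
      rw [hPs a b, hPs a (σ b), add_comm (P b a)]
      simpa [σ] using hPc a hai haj
    have hb : σ b = b := Equiv.swap_apply_of_ne_of_ne hbi hbj
    rw [hb, hP0 a b hai haj hbi hbj, add_zero]
  have hfix : ∀ a b, a < b → ((σ a = a ∧ σ b = b) ∨ (σ a = b ∧ σ b = a)) → P a b = 0 := by
    intro a b hab h
    by_cases hai : a = i
    · subst hai
      have : σ a = j := by simp [σ]
      rcases h with h | h
      · exact absurd (h.1.symm.trans this) hij
      · rw [← h.1, this, hPij]
    by_cases haj : a = j
    · subst haj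
      have : σ a = i := by simp [σ]
      rcases h with h | h
      · exact absurd (h.1.symm.trans this) hij.symm
      · rw [← h.1, this, hPs, hPij]
    have ha : σ a = a := Equiv.swap_apply_of_ne_of_ne hai haj
    rcases h with h | h
    · refine hP0 a b hai haj ?_ ?_
      · rintro rfl
        exact hij (by simpa [σ] using h.2.symm)
      · rintro rfl
        exact hij (by simpa [σ] using h.2)
    · exact absurd (ha.symm.trans h.1) hab.ne
  refine Finset.sum_involution
    (fun x _ => if σ x.2 < σ x.1 then (σ x.1, σ x.2) else (σ x.2, σ x.1)) ?_ ?_ ?_ ?_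
  · rintro ⟨b, a⟩ _
    dsimp only
    split_ifs
    · exact hσ a b
    · rw [hPs (σ b) (σ a)]
      exact hσ a b
  · rintro ⟨b, a⟩ hx hne heq
    have hab : a < b := by simpa using hx
    apply hne
    dsimp only at heq ⊢
    split_ifs at heq with h
    · exact hfix a b hab (Or.inl ⟨(Prod.ext_iff.1 heq).2, (Prod.ext_iff.1 heq).1⟩)
    · exact hfix a b hab (Or.inr ⟨(Prod.ext_iff.1 heq).1, (Prod.ext_iff.1 heq).2⟩)
  · rintro ⟨b, a⟩ hx
    have hab : a < b := by simpa using hx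
    have hne : σ a ≠ σ b := σ.injective.ne hab.ne
    dsimp only
    split_ifs with h
    · simpa using h
    · simpa using lt_of_le_of_ne (not_lt.1 h) hne.symm
  · rintro ⟨b, a⟩ hx
    have hab : a < b := by simpa using hx
    have h1 : ∀ x, σ (σ x) = x := fun x => Equiv.swap_apply_self i j x
    dsimp only
    split_ifs with h h2 h2
    · simp [h1]
    · exact absurd (by simpa [h1] using hab) h2
    · exact absurd (by simpa [h1] using h2) hab.not_gt
    · simp [h1]

variable (R L)

/-- The alternating map
`(v 0, …, v (k+1)) ↦ ∑_{r < s} (-1)^(r+s) ⁅v r, v s⁆ ∧ v 0 ∧ … ∧ v (k+1)`,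
with `v r` and `v s` omitted from the last product. (If `r < s`, the `r`-th entry of `v` is also
the `r`-th entry after removal of the `s`-th one. Positions are counted from `0` instead of `1`,
which does not change the parity of `r + s`.) -/
def boundaryAlternating (k : ℕ) : L [⋀^Fin (k + 2)]→ₗ[R] ⋀[R]^(k + 1) L where
  toFun v := ∑ s : Fin (k + 2), ∑ r : Fin (k + 1),
    if r.castSucc < s then (-1 : ℤ) ^ ((s : ℕ) + (r : ℕ)) • bracketWedge R L v s r else 0
  map_update_add' {inst} v i x y := by
    obtain rfl : inst = instDecidableEqFin (k + 2) := Subsingleton.elim _ _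
    simp only [bracketWedge_update_add, ← Finset.sum_add_distrib]
    refine Finset.sum_congr rfl fun s _ => Finset.sum_congr rfl fun r _ => ?_
    split_ifs <;> simp
  map_update_smul' {inst} v i c x := by
    obtain rfl : inst = instDecidableEqFin (k + 2) := Subsingleton.elim _ _
    simp only [bracketWedge_update_smul, Finset.smul_sum]
    refine Finset.sum_congr rfl fun s _ => Finset.sum_congr rfl fun r _ => ?_
    split_ifs
    · rw [smul_comm]
    · simp
  map_eq_zero_of_eq' v i j hv hij := sum_bracketWedge_eq_zero v i j hv hij

/-- The boundary `∂ : Λ^(k+1) L → Λ^k L` of the Chevalley complex of `L` with trivial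
coefficients; it is `0` for `k = 0`. -/
def boundary : (k : ℕ) → ⋀[R]^(k + 1) L →ₗ[R] ⋀[R]^k L
  | 0 => 0
  | k + 1 => exteriorPower.alternatingMapLinearEquiv (boundaryAlternating R L k)

theorem boundary_ιMulti (k : ℕ) (v : Fin (k + 2) → L) :
    boundary R L (k + 1) (exteriorPower.ιMulti R (k + 2) v) =
      ∑ s : Fin (k + 2), ∑ r : Fin (k + 1),
        if r.castSucc < s then
          (-1 : ℤ) ^ ((s : ℕ) + (r : ℕ)) • exteriorPower.ιMulti R (k + 1)
            (Matrix.vecCons ⁅v r.castSucc, v s⁆ (r.removeNth (s.removeNth v)))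
        else 0 := by
  simp only [boundary, exteriorPower.alternatingMapLinearEquiv_apply_ιMulti]
  change ∑ s : Fin (k + 2), ∑ r : Fin (k + 1), _ = _
  refine Finset.sum_congr rfl fun s _ => Finset.sum_congr rfl fun r _ => ?_
  split_ifs with h
  · rw [bracketWedge, Fin.succAbove_of_castSucc_lt s r h]
  · rfl

/-- The map leaving `Λ^k L` in the Chevalley complex: the boundary `Λ^k L → Λ^(k-1) L` if `k ≥ 1`,
and the zero map if `k = 0` (the target `Λ^(0-1) L` is then a placeholder). -/
def outgoing : (k : ℕ) → ⋀[R]^k L →ₗ[R] ⋀[R]^(k - 1) L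
  | 0 => 0
  | k + 1 => boundary R L k

/-- The homology `H_k(L; R)` with trivial coefficients, i.e. the homology at `Λ^k L` of
`Λ^(k+1) L → Λ^k L → Λ^(k-1) L`. -/
abbrev Homology (k : ℕ) : Type _ :=
  KerModRange (boundary R L k) (outgoing R L k)

/-- The cohomology `H^k(L; R)` with trivial coefficients, i.e. the cohomology at
`Hom_R(Λ^k L, R)` of the `R`-linear dual of the Chevalley complex. -/
abbrev Cohomology (k : ℕ) : Type _ :=
  KerModRange (outgoing R L k).dualMap (boundary R L k).dualMap

end Boundary

end ChevalleyEilenberg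

section Sol

attribute [local instance] LieRing.ofAssociativeRing

/-- The Lie algebra `sol_n(R)` of all upper triangular `n × n` matrices over `R`, with bracket
`⁅a, b⁆ = a * b - b * a`. -/
abbrev sol (R : Type*) [CommRing R] (n : ℕ) : LieSubalgebra R (Matrix (Fin n) (Fin n) R) :=
  lieSubalgebraOfSubalgebra R (Matrix (Fin n) (Fin n) R)
    (Matrix.blockTriangularSubalgebra R R (id : Fin n → Fin n))

theorem mem_sol_iff (R : Type*) [CommRing R] (n : ℕ) (a : Matrix (Fin n) (Fin n) R) :
    a ∈ sol R n ↔ ∀ i j, ¬ i ≤ j → a i j = 0 := by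
  simp only [not_le]
  rfl

end Sol

/-- The module `H_k(sol_n; R)`. -/
abbrev solHomology (R : Type*) [CommRing R] (n k : ℕ) : Type _ :=
  ChevalleyEilenberg.Homology R (sol R n) k

/-- The module `H^k(sol_n; R)`. -/
abbrev solCohomology (R : Type*) [CommRing R] (n k : ℕ) : Type _ :=
  ChevalleyEilenberg.Cohomology R (sol R n) k

/-- The binomial coefficient `n` over `k - m`, which is `0` if `k < m`. -/
def shiftedChoose (n k m : ℕ) : ℕ :=
  if m ≤ k then n.choose (k - m) else 0

/-- The abelian group `M` has `p`-torsion: an element of order `p`, for `p` prime. -/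
def HasTorsion (p : ℕ) (M : Type*) [AddCommGroup M] : Prop :=
  ∃ x : M, x ≠ 0 ∧ p • x = 0

/-- The abelian group `M` has a direct summand isomorphic to `ℤ / p ^ l` for some `l ≥ 1`. -/
def HasPrimePowerSummand (p : ℕ) (M : Type*) [AddCommGroup M] : Prop :=
  ∃ l : ℕ, 1 ≤ l ∧ ∃ N : AddSubgroup M, Nonempty (M ≃+ ZMod (p ^ l) × N)

end

/-!
The diagonal matrices act on `Λ(sol_n)` with integral weights: the wedge of the matrix units at a
set `S` of positions has weight `∑ (ε_i - ε_j)` over the `(i, j) ∈ S`. By Cartan's formula, a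
diagonal matrix `h` yields a homotopy `h ∧ ·` which contracts the part of weight `α` up to the
scalar `α(h)`. If some coordinate of `α` is prime to `p`, then a suitable integral combination
of the diagonal matrix units has `α(h) ≡ 1` modulo `p`. So (`exists_homotopy`), up to multiples
of `p`, the complex contracts onto the weights which are divisible by `p`.

A set of positions above the diagonal with such a weight is scarce. If it is nonempty, then the
least index which occurs, `i`, is the row of at least `p` positions and the greatest, `j`, is the
column of at least `p` positions (`exists_extremal`); only `(i, j)` can be counted twice. Hence
`n ≥ p + 1` and the set has at least `2p - 1` elements. For `n = p + 1`, and for sets of `2p - 1`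
elements, the set has to be `(i, j)` together with `(i, v), (v, j)` for `v` in a set `V` of `p - 1`
indices between `i` and `j` (`eq_insert_pathSet_of_weight_dvd`, `exists_eq_insert_pathSet`).

Below these bounds, the only sets with weight divisible by `p` are those of diagonal positions,
and no coordinate of a boundary at such a set is nonzero; over `ℤ` this excludes `p`-torsion
(`not_hasTorsion`).

The wedge `Z_V` of `e_ij` and of the `e_iv ∧ e_vj` with `v ∈ V` is a cycle (`pathCycle`).

* Its weight is `p (ε_i - ε_j)`, so `∂(-e_ii ∧ Z_V) = p Z_V` and its class is killed by `p`.
* Two sets `V` of the same size give homologous cycles: for `u < w`, the boundary of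
  `e_iu ∧ e_uw ∧ e_wj ∧ Z_V` is `Z_{V ∪ u} - Z_{V ∪ w}` (`pathCycle_sub_mem`).
* The form which is `1` on all `Z_V` with `#V = p - 1` is a cocycle modulo `p`
  (`dvd_pathForm_totalBoundary`): on chains without diagonal factors, the only boundaries which
  involve such `Z_V` are these differences and that of a product of `p` terms `e_iv ∧ e_vj`,
  which is minus a sum of `p` of the `Z_V`.

So `Z_V` generates a summand `ℤ/p` of `H_{2p-1}(sol_{p+1}; ℤ)` (`hasPrimePowerSummand`). In
characteristic `p`, the homology in degree `2p - 1` is free on the classes of the wedges of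
`2p - 1` diagonal units and on one class `Z_V` for each `(i, j)` with `j - i ≥ p`. For
`n = p + 1`, the differential vanishes on the weights divisible by `p`, so that homology and
cohomology are read off by counting the sets with such a weight.
-/

noncomputable section

/-! ### The Chevalley boundary on the exterior algebra -/

namespace ChevalleyEilenberg

section TotalBoundary

variable (R : Type*) [CommRing R] (L : Type*) [LieRing L] [LieAlgebra R L]

open ExteriorAlgebra

/-- The Chevalley boundary as an endomorphism of the whole exterior algebra; it vanishes on
`Λ^0` and `Λ^1`. -/
def totalBoundary : ExteriorAlgebra R L →ₗ[R] ExteriorAlgebra R L :=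
  ExteriorAlgebra.liftAlternating fun k => match k with
    | 0 => 0
    | 1 => 0
    | k + 2 => (Submodule.subtype _).compAlternatingMap (boundaryAlternating R L k)

variable {R L}

theorem coe_boundary (k : ℕ) (z : ⋀[R]^(k + 1) L) :
    (boundary R L k z : ExteriorAlgebra R L) = totalBoundary R L z := by
  suffices h : (Submodule.subtype _) ∘ₗ boundary R L k =
      totalBoundary R L ∘ₗ Submodule.subtype _ from LinearMap.congr_fun h z
  ext v
  simp only [LinearMap.compAlternatingMap_apply, LinearMap.comp_apply, Submodule.subtype_apply,
    exteriorPower.ιMulti_apply_coe, totalBoundary, liftAlternating_apply_ιMulti]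
  cases k with
  | zero => rfl
  | succ k => simp [boundary]

theorem totalBoundary_one : totalBoundary R L 1 = 0 := by
  simp [totalBoundary]

theorem totalBoundary_ι (x : L) : totalBoundary R L (ι R x) = 0 := by
  simp [totalBoundary]

theorem totalBoundary_of_mem_zero {z : ExteriorAlgebra R L} (hz : z ∈ ⋀[R]^0 L) :
    totalBoundary R L z = 0 := by
  rw [← exteriorPower.ιMulti_span_fixedDegree] at hz
  induction hz using Submodule.span_induction with
  | mem x h => obtain ⟨v, rfl⟩ := h; simp [totalBoundary_one]
  | zero => simp
  | add x y _ _ hx hy => simp [hx, hy]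
  | smul c x _ hx => simp [hx]

theorem coe_outgoing (k : ℕ) (z : ⋀[R]^k L) :
    (outgoing R L k z : ExteriorAlgebra R L) = totalBoundary R L z := by
  cases k with
  | zero => simp [outgoing, totalBoundary_of_mem_zero z.2]
  | succ k => exact coe_boundary k z

theorem totalBoundary_ιMulti (k : ℕ) (v : Fin (k + 2) → L) :
    totalBoundary R L (ιMulti R (k + 2) v) =
      ∑ s : Fin (k + 2), ∑ r : Fin (k + 1),
        if r.castSucc < s then
          (-1 : ℤ) ^ ((s : ℕ) + (r : ℕ)) • (ι R ⁅v r.castSucc, v s⁆ *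
            ιMulti R k (r.removeNth (s.removeNth v)))
        else 0 := by
  have h := coe_boundary (k + 1) (exteriorPower.ιMulti R (k + 2) v)
  rw [exteriorPower.ιMulti_apply_coe] at h
  rw [← h, boundary_ιMulti, AddSubmonoidClass.coe_finsetSum]
  refine Finset.sum_congr rfl fun s _ => ?_
  rw [AddSubmonoidClass.coe_finsetSum]
  refine Finset.sum_congr rfl fun r _ => ?_
  split_ifs with h
  · rw [Submodule.coe_smul_of_tower, exteriorPower.ιMulti_apply_coe, ιMulti_succ_apply]
    simp [Matrix.vecTail, Function.comp_def]
  · rfl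

variable (R) in
/-- The action of `x : L` on the exterior algebra, defined through Cartan's formula
`θ_x = -(∂ ∘ (x ∧ ·) + (x ∧ ·) ∘ ∂)`. -/
def lieDer (x : L) : ExteriorAlgebra R L →ₗ[R] ExteriorAlgebra R L :=
  -(totalBoundary R L ∘ₗ LinearMap.mulLeft R (ι R x) +
    LinearMap.mulLeft R (ι R x) ∘ₗ totalBoundary R L)

/-- Cartan's formula, solved for the boundary of a product. -/
theorem totalBoundary_ι_mul (x : L) (z : ExteriorAlgebra R L) :
    totalBoundary R L (ι R x * z) = -(ι R x * totalBoundary R L z) - lieDer R x z := by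
  simp [lieDer]

theorem lieDer_one (x : L) : lieDer R x 1 = 0 := by
  simp [lieDer, totalBoundary_ι, totalBoundary_one]

theorem ι_mul_ι_mul_swap (x y : L) (z : ExteriorAlgebra R L) :
    ι R x * (ι R y * z) = -(ι R y * (ι R x * z)) := by
  rw [← mul_assoc, ← mul_assoc, eq_neg_iff_add_eq_zero, ← add_mul, ι_add_mul_swap, zero_mul]

theorem ιMulti_cons (x : L) {k : ℕ} (v : Fin k → L) :
    ιMulti R (k + 1) (Fin.cons x v : Fin (k + 1) → L) = ι R x * ιMulti R k v := by
  rw [ιMulti_succ_apply]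
  simp [Matrix.vecTail, Function.comp_def]

theorem removeNth_succ_cons {M : Type*} (x : M) {k : ℕ} (v : Fin (k + 1) → M)
    (s : Fin (k + 1)) :
    s.succ.removeNth (Fin.cons x v : Fin (k + 2) → M) = Fin.cons x (s.removeNth v) := by
  ext i
  refine Fin.cases ?_ (fun i => ?_) i <;> simp [Fin.removeNth]

theorem lieDer_ιMulti (x : L) (k : ℕ) (v : Fin (k + 1) → L) :
    lieDer R x (ιMulti R (k + 1) v) =
      ∑ s : Fin (k + 1), (-1 : ℤ) ^ (s : ℕ) • (ι R ⁅x, v s⁆ * ιMulti R k (s.removeNth v)) := by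
  have key : totalBoundary R L (ι R x * ιMulti R (k + 1) v) =
      -(ι R x * totalBoundary R L (ιMulti R (k + 1) v)) -
      ∑ s : Fin (k + 1), (-1 : ℤ) ^ (s : ℕ) • (ι R ⁅x, v s⁆ * ιMulti R k (s.removeNth v)) := by
    rw [← ιMulti_cons, totalBoundary_ιMulti, Fin.sum_univ_succ]
    simp only [Fin.not_lt_zero, if_false, Finset.sum_const_zero, zero_add]
    rw [Finset.sum_congr rfl fun s _ => Fin.sum_univ_succ _, Finset.sum_add_distrib]
    simp only [Fin.castSucc_zero, Fin.succ_pos, if_true, Fin.val_zero, Fin.val_succ, Fin.cons_zero,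
      Fin.cons_succ, add_zero, removeNth_succ_cons]
    rw [sub_eq_add_neg, add_comm]
    congr 1
    · cases k with
      | zero =>
        rw [show totalBoundary R L (ιMulti R (0 + 1) v) = 0 by simp [totalBoundary]]
        simp
      | succ k =>
        rw [totalBoundary_ιMulti, Finset.mul_sum, ← Finset.sum_neg_distrib]
        refine Finset.sum_congr rfl fun s _ => ?_
        rw [Finset.mul_sum, ← Finset.sum_neg_distrib]
        refine Finset.sum_congr rfl fun r _ => ?_
        have hlt : r.succ.castSucc < s.succ ↔ r.castSucc < s := by
          simp [Fin.lt_def]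
        simp only [hlt]
        split_ifs with h
        · rw [removeNth_succ_cons, ιMulti_cons, Fin.castSucc_succ, Fin.cons_succ, mul_smul_comm,
            ι_mul_ι_mul_swap x, smul_neg, neg_neg, pow_add, pow_succ (-1 : ℤ) (s : ℕ),
            pow_succ (-1 : ℤ) (r : ℕ), pow_add]
          simp
        · simp
    · rw [← Finset.sum_neg_distrib]
      refine Finset.sum_congr rfl fun s _ => ?_
      rw [pow_succ, Fin.removeNth_zero, Fin.tail_cons]
      simp
  rw [totalBoundary_ι_mul] at key
  simpa using key

/-- The action is by derivations which extend the adjoint action. Together with Cartan's formula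
`totalBoundary_ι_mul`, this computes boundaries of products recursively. -/
theorem lieDer_ι_mul (x y : L) (z : ExteriorAlgebra R L) :
    lieDer R x (ι R y * z) = ι R ⁅x, y⁆ * z + ι R y * lieDer R x z := by
  suffices h : lieDer R x ∘ₗ LinearMap.mulLeft R (ι R y) =
      LinearMap.mulLeft R (ι R ⁅x, y⁆) + LinearMap.mulLeft R (ι R y) ∘ₗ lieDer R x by
    simpa using LinearMap.congr_fun h z
  ext m v
  simp only [LinearMap.compAlternatingMap_apply, LinearMap.comp_apply, LinearMap.mulLeft_apply,
    LinearMap.add_apply]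
  rw [← ιMulti_cons, lieDer_ιMulti]
  cases m with
  | zero => simp [lieDer_one]
  | succ k =>
    rw [Fin.sum_univ_succ, lieDer_ιMulti, Finset.mul_sum]
    congr 1
    · simp
    · refine Finset.sum_congr rfl fun s _ => ?_
      rw [removeNth_succ_cons, ιMulti_cons, Fin.cons_succ, ι_mul_ι_mul_swap, Fin.val_succ,
        pow_succ, mul_smul_comm]
      simp

end TotalBoundary

end ChevalleyEilenberg

/-! ### Bases, weights and the torus homotopy -/

namespace ChevalleyEilenberg

section Basis

open ExteriorAlgebra Module

variable {R : Type*} [CommRing R] {L : Type*} [AddCommGroup L] [Module R L]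
  {I : Type*} [LinearOrder I] (b : Basis I R L)

theorem basis_exteriorAlgebra_empty : b.ExteriorAlgebra ∅ = 1 := by
  rw [ExteriorAlgebra.basis_apply_ofCard b (n := 0) (by simp)]
  simp [ExteriorAlgebra.ιMulti_family]

theorem basis_exteriorAlgebra_singleton (i : I) : b.ExteriorAlgebra {i} = ι R (b i) := by
  rw [ExteriorAlgebra.basis_apply_ofCard b (n := 1) (by simp)]
  simp [ExteriorAlgebra.ιMulti_family, Set.powersetCard.ofFinEmbEquiv_symm_apply]

theorem ι_mul_basis_of_mem {i : I} {S : Finset I} (h : i ∈ S) :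
    ι R (b i) * b.ExteriorAlgebra S = 0 := by
  have := ExteriorAlgebra.basis_mul_of_not_disjoint b
    (Set.powersetCard.ofCard (Finset.card_singleton i)) (Set.powersetCard.ofCard (s := S) rfl)
    (by simpa using h)
  rw [← basis_exteriorAlgebra_singleton]
  exact this

theorem ι_mul_basis_of_notMem {i : I} {S : Finset I} (h : i ∉ S) :
    ∃ ε : ℤˣ, ι R (b i) * b.ExteriorAlgebra S = ε • b.ExteriorAlgebra (insert i S) := by
  have hd : Disjoint (Set.powersetCard.ofCard (Finset.card_singleton i)).val
    (Set.powersetCard.ofCard (s := S) rfl).val := by simpa using h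
  have := ExteriorAlgebra.basis_mul_of_disjoint b
    (Set.powersetCard.ofCard (Finset.card_singleton i)) (Set.powersetCard.ofCard (s := S) rfl) hd
  refine ⟨Equiv.Perm.sign (Set.powersetCard.permOfDisjoint hd), ?_⟩
  rw [← basis_exteriorAlgebra_singleton]
  refine this.trans ?_
  congr 2
  simp [Set.powersetCard.disjUnion]

theorem basis_mem_exteriorPower (S : Finset I) :
    b.ExteriorAlgebra S ∈ ⋀[R]^(S.card) L := by
  rw [ExteriorAlgebra.basis_apply_ofCard b rfl, ← exteriorPower.ιMulti_family_apply_coe]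
  exact Submodule.coe_mem _

/-- `Λ^k` inside the exterior algebra is spanned by the basis elements at the sets with `k`
elements. -/
theorem mem_exteriorPower_iff {k : ℕ} {z : ExteriorAlgebra R L} :
    z ∈ ⋀[R]^k L ↔ ∀ S, b.ExteriorAlgebra.repr z S ≠ 0 → S.card = k := by
  have h : ⋀[R]^k L = Submodule.span R (b.ExteriorAlgebra '' {S | S.card = k}) := by
    rw [← exteriorPower.ιMulti_family_span_fixedDegree_of_span R b.span_eq]
    congr 1
    ext z
    constructor
    · rintro ⟨S, rfl⟩
      exact ⟨S, S.2, ExteriorAlgebra.basis_apply_powersetCard b S⟩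
    · rintro ⟨S, hS, rfl⟩
      exact ⟨Set.powersetCard.ofCard hS, (ExteriorAlgebra.basis_apply_ofCard b hS).symm⟩
  rw [h, Basis.mem_span_image]
  simp [Set.subset_def]

theorem basis_insert {i : I} {S : Finset I} (h : i ∉ S) :
    ∃ ε : ℤˣ, b.ExteriorAlgebra (insert i S) = ε • (ι R (b i) * b.ExteriorAlgebra S) := by
  obtain ⟨ε, hε⟩ := ι_mul_basis_of_notMem b h
  exact ⟨ε, by rw [hε, smul_smul, Int.units_mul_self, one_smul]⟩

theorem repr_ι_mul_of_notMem {i : I} {S : Finset I} (h : i ∉ S) (z : ExteriorAlgebra R L) :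
    b.ExteriorAlgebra.repr (ι R (b i) * z) S = 0 := by
  suffices H : b.ExteriorAlgebra.coord S ∘ₗ LinearMap.mulLeft R (ι R (b i)) = 0 from
    LinearMap.congr_fun H z
  refine b.ExteriorAlgebra.ext fun T => ?_
  by_cases hT : i ∈ T
  · simp [ι_mul_basis_of_mem b hT]
  · obtain ⟨ε, hε⟩ := ι_mul_basis_of_notMem b hT
    have hne : insert i T ≠ S := fun h' => h (h' ▸ Finset.mem_insert_self i T)
    rw [LinearMap.comp_apply, LinearMap.mulLeft_apply, hε, Units.smul_def, map_zsmul]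
    simp [hne]

/-- The endomorphism of the exterior algebra which multiplies the basis element indexed by `S`
by `c S`. -/
def diagonal (c : Finset I → R) : ExteriorAlgebra R L →ₗ[R] ExteriorAlgebra R L :=
  b.ExteriorAlgebra.constr R fun S => c S • b.ExteriorAlgebra S

theorem diagonal_basis (c : Finset I → R) (S : Finset I) :
    diagonal b c (b.ExteriorAlgebra S) = c S • b.ExteriorAlgebra S := by
  simp [diagonal]

theorem repr_diagonal (c : Finset I → R) (z : ExteriorAlgebra R L) (S : Finset I) :
    b.ExteriorAlgebra.repr (diagonal b c z) S = c S * b.ExteriorAlgebra.repr z S := by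
  suffices H : b.ExteriorAlgebra.coord S ∘ₗ diagonal b c = c S • b.ExteriorAlgebra.coord S from
    LinearMap.congr_fun H z
  refine b.ExteriorAlgebra.ext fun T => ?_
  by_cases hT : T = S
  · subst hT; simp [diagonal_basis]
  · simp [diagonal_basis, hT]

theorem diagonal_mem_exteriorPower (c : Finset I → R) {k : ℕ} {z : ExteriorAlgebra R L}
    (hz : z ∈ ⋀[R]^k L) : diagonal b c z ∈ ⋀[R]^k L := by
  rw [mem_exteriorPower_iff b] at hz ⊢
  intro S hS
  rw [repr_diagonal] at hS
  exact hz S (right_ne_zero_of_mul hS)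

theorem ι_mul_mem_exteriorPower (x : L) {k : ℕ} {z : ExteriorAlgebra R L}
    (hz : z ∈ ⋀[R]^k L) : ι R x * z ∈ ⋀[R]^(k + 1) L := by
  change ι R x * z ∈ (LinearMap.range (ι R : L →ₗ[R] ExteriorAlgebra R L)) ^ (k + 1)
  rw [pow_succ']
  exact Submodule.mul_mem_mul ⟨x, rfl⟩ hz

/-- The span of the basis elements of the exterior algebra of weight `α`, where `w` assigns a
weight to each basis vector of `L` and weights add up in products. -/
def weightSpace {Γ : Type*} [AddCommGroup Γ] (w : I → Γ) (α : Γ) :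
    Submodule R (ExteriorAlgebra R L) :=
  Submodule.span R (b.ExteriorAlgebra '' {S | ∑ i ∈ S, w i = α})

variable {Γ : Type*} [AddCommGroup Γ] (w : I → Γ)

theorem basis_mem_weightSpace (S : Finset I) :
    b.ExteriorAlgebra S ∈ weightSpace b w (∑ i ∈ S, w i) :=
  Submodule.subset_span ⟨S, rfl, rfl⟩

theorem repr_eq_zero_of_mem_weightSpace {α : Γ} {z : ExteriorAlgebra R L}
    (hz : z ∈ weightSpace b w α) {S : Finset I} (hS : ∑ i ∈ S, w i ≠ α) :
    b.ExteriorAlgebra.repr z S = 0 := by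
  rw [weightSpace, Basis.mem_span_image] at hz
  by_contra h
  exact hS (hz (by simpa using h))

theorem diagonal_of_mem_weightSpace (c : Γ → R) {α : Γ} {z : ExteriorAlgebra R L}
    (hz : z ∈ weightSpace b w α) : diagonal b (fun S => c (∑ i ∈ S, w i)) z = c α • z := by
  refine b.ExteriorAlgebra.repr.injective (Finsupp.ext fun S => ?_)
  rw [repr_diagonal]
  by_cases hS : ∑ i ∈ S, w i = α
  · simp [hS]
  · simp [repr_eq_zero_of_mem_weightSpace b w hz hS]

theorem ι_mul_mem_weightSpace {x : L} {β : Γ} (hx : x ∈ Submodule.span R (b '' {l | w l = β}))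
    {α : Γ} {z : ExteriorAlgebra R L} (hz : z ∈ weightSpace b w α) :
    ι R x * z ∈ weightSpace b w (β + α) := by
  induction hx using Submodule.span_induction with
  | mem x h =>
    obtain ⟨i, rfl, rfl⟩ := h
    induction hz using Submodule.span_induction with
    | mem z h =>
      obtain ⟨S, rfl, rfl⟩ := h
      by_cases hi : i ∈ S
      · simp [ι_mul_basis_of_mem b hi]
      · obtain ⟨ε, hε⟩ := ι_mul_basis_of_notMem b hi
        rw [hε, ← Finset.sum_insert hi, Units.smul_def]
        exact Submodule.smul_of_tower_mem _ _ (basis_mem_weightSpace b w _)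
    | zero => simp
    | add x y _ _ hx hy => rw [mul_add]; exact add_mem hx hy
    | smul c x _ hx => rw [mul_smul_comm]; exact Submodule.smul_mem _ _ hx
  | zero => simp
  | add x y _ _ hx hy => rw [map_add, add_mul]; exact add_mem hx hy
  | smul c x _ hx => rw [map_smul, smul_mul_assoc]; exact Submodule.smul_mem _ _ hx

end Basis

section Weights

open ExteriorAlgebra Module

variable {R : Type*} [CommRing R] {L : Type*} [LieRing L] [LieAlgebra R L]
  {I : Type*} [LinearOrder I] (b : Basis I R L) {Γ : Type*} [AddCommGroup Γ] {w : I → Γ}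

theorem lieDer_basis_mem_weightSpace
    (hw : ∀ i j, ⁅b i, b j⁆ ∈ Submodule.span R (b '' {l | w l = w i + w j}))
    (i : I) (S : Finset I) :
    lieDer R (b i) (b.ExteriorAlgebra S) ∈ weightSpace b w (w i + ∑ j ∈ S, w j) := by
  induction S using Finset.induction_on with
  | empty => simp [basis_exteriorAlgebra_empty, lieDer_one]
  | insert j S hj ih =>
    obtain ⟨ε, hε⟩ := basis_insert b hj
    rw [hε, Units.smul_def, map_zsmul, lieDer_ι_mul, Finset.sum_insert hj]
    refine zsmul_mem (add_mem ?_ ?_) _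
    · rw [← add_assoc]
      exact ι_mul_mem_weightSpace b w (hw i j) (basis_mem_weightSpace b w S)
    · rw [add_left_comm]
      exact ι_mul_mem_weightSpace b w (Submodule.subset_span ⟨j, rfl, rfl⟩) ih

/-- The boundary preserves weights. -/
theorem totalBoundary_basis_mem_weightSpace
    (hw : ∀ i j, ⁅b i, b j⁆ ∈ Submodule.span R (b '' {l | w l = w i + w j}))
    (S : Finset I) :
    totalBoundary R L (b.ExteriorAlgebra S) ∈ weightSpace b w (∑ j ∈ S, w j) := by
  induction S using Finset.induction_on with
  | empty => simp [basis_exteriorAlgebra_empty, totalBoundary_one]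
  | insert j S hj ih =>
    obtain ⟨ε, hε⟩ := basis_insert b hj
    rw [hε, Units.smul_def, map_zsmul, totalBoundary_ι_mul, Finset.sum_insert hj]
    refine zsmul_mem (sub_mem (neg_mem ?_) (lieDer_basis_mem_weightSpace b hw j S)) _
    exact ι_mul_mem_weightSpace b w (Submodule.subset_span ⟨j, rfl, rfl⟩) ih

theorem totalBoundary_diagonal
    (hw : ∀ i j, ⁅b i, b j⁆ ∈ Submodule.span R (b '' {l | w l = w i + w j}))
    (c : Γ → R) (z : ExteriorAlgebra R L) :
    totalBoundary R L (diagonal b (fun S => c (∑ i ∈ S, w i)) z) =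
      diagonal b (fun S => c (∑ i ∈ S, w i)) (totalBoundary R L z) := by
  suffices H : totalBoundary R L ∘ₗ diagonal b (fun S => c (∑ i ∈ S, w i)) =
      diagonal b (fun S => c (∑ i ∈ S, w i)) ∘ₗ totalBoundary R L from LinearMap.congr_fun H z
  refine b.ExteriorAlgebra.ext fun S => ?_
  rw [LinearMap.comp_apply, LinearMap.comp_apply, diagonal_basis, map_smul,
    diagonal_of_mem_weightSpace b w c (totalBoundary_basis_mem_weightSpace b hw S)]

/-- An element of `L` acting diagonally on the basis `b` acts diagonally on the exterior
algebra. -/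
theorem lieDer_basis_of_lie_eq_smul {h : L} {χ : I → ℤ}
    (hχ : ∀ i, ⁅h, b i⁆ = (χ i : R) • b i) (S : Finset I) :
    lieDer R h (b.ExteriorAlgebra S) = ((∑ i ∈ S, χ i : ℤ) : R) • b.ExteriorAlgebra S := by
  induction S using Finset.induction_on with
  | empty => simp [basis_exteriorAlgebra_empty, lieDer_one]
  | insert j S hj ih =>
    obtain ⟨ε, hε⟩ := basis_insert b hj
    rw [hε, Units.smul_def, map_zsmul, lieDer_ι_mul, Finset.sum_insert hj, ih, hχ, map_smul,
      smul_mul_assoc, mul_smul_comm, ← add_smul, smul_comm]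
    push_cast
    rfl

variable {A : Type*} [Fintype A] {χ : I → A → ℤ} {h : A → L}

/-- A combination, with coefficients depending on the weight only, of the exterior
multiplications by the elements `h a`. -/
def torusHomotopy (h : A → L) (χ : I → A → ℤ) (c : (A → ℤ) → A → R) :
    ExteriorAlgebra R L →ₗ[R] ExteriorAlgebra R L :=
  -∑ a, LinearMap.mulLeft R (ι R (h a)) ∘ₗ diagonal b (fun S => c (∑ i ∈ S, χ i) a)

theorem torusHomotopy_mem_exteriorPower (c : (A → ℤ) → A → R) {k : ℕ}
    {z : ExteriorAlgebra R L} (hz : z ∈ ⋀[R]^k L) :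
    torusHomotopy b h χ c z ∈ ⋀[R]^(k + 1) L := by
  simp only [torusHomotopy, LinearMap.neg_apply, LinearMap.sum_apply, LinearMap.comp_apply,
    LinearMap.mulLeft_apply]
  exact neg_mem (sum_mem fun a _ =>
    ι_mul_mem_exteriorPower _ (diagonal_mem_exteriorPower b _ hz))

/-- Cartan's formula: the torus homotopy contracts onto the weights at which
`∑ a, α a * c α a` vanishes. -/
theorem totalBoundary_torusHomotopy
    (hw : ∀ i j, ⁅b i, b j⁆ ∈ Submodule.span R (b '' {l | χ l = χ i + χ j}))
    (hh : ∀ a i, ⁅h a, b i⁆ = (χ i a : R) • b i) (c : (A → ℤ) → A → R)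
    (z : ExteriorAlgebra R L) :
    totalBoundary R L (torusHomotopy b h χ c z) + torusHomotopy b h χ c (totalBoundary R L z) =
      diagonal b (fun S => ∑ a, (((∑ i ∈ S, χ i) a : ℤ) : R) * c (∑ i ∈ S, χ i) a) z := by
  have hder : ∀ a, ∀ x : ExteriorAlgebra R L, lieDer R (h a) (diagonal b
      (fun S => c (∑ i ∈ S, χ i) a) x) = diagonal b
      (fun S => (((∑ i ∈ S, χ i) a : ℤ) : R) * c (∑ i ∈ S, χ i) a) x := by
    intro a x
    suffices H : lieDer R (h a) ∘ₗ diagonal b (fun S => c (∑ i ∈ S, χ i) a) = diagonal b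
      (fun S => (((∑ i ∈ S, χ i) a : ℤ) : R) * c (∑ i ∈ S, χ i) a) from LinearMap.congr_fun H x
    refine b.ExteriorAlgebra.ext fun S => ?_
    rw [LinearMap.comp_apply, diagonal_basis, diagonal_basis, map_smul,
      lieDer_basis_of_lie_eq_smul b (hh a), smul_smul, Finset.sum_apply, mul_comm]
  have hsum : diagonal b (fun S => ∑ a, (((∑ i ∈ S, χ i) a : ℤ) : R) * c (∑ i ∈ S, χ i) a) =
      ∑ a, diagonal b (fun S => (((∑ i ∈ S, χ i) a : ℤ) : R) * c (∑ i ∈ S, χ i) a) := by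
    refine b.ExteriorAlgebra.ext fun S => ?_
    simp [diagonal_basis, LinearMap.sum_apply, Finset.sum_smul]
  rw [hsum]
  simp only [torusHomotopy, LinearMap.neg_apply, LinearMap.sum_apply, LinearMap.comp_apply,
    LinearMap.mulLeft_apply, map_neg, map_sum]
  rw [← neg_add, ← Finset.sum_add_distrib, ← Finset.sum_neg_distrib]
  refine Finset.sum_congr rfl fun a _ => ?_
  rw [← hder, totalBoundary_ι_mul, totalBoundary_diagonal b hw (fun α => c α a)]
  abel

end Weights

/-! ### Computing homology modules -/

section KerModRange

variable {R A B C M : Type*} [CommRing R] [AddCommGroup A] [Module R A]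
  [AddCommGroup B] [Module R B] [AddCommGroup C] [Module R C] [AddCommGroup M] [Module R M]

/-- The class of a cycle. -/
def KerModRange.mk (f : A →ₗ[R] B) (g : B →ₗ[R] C) : LinearMap.ker g →ₗ[R] KerModRange f g :=
  Submodule.mkQ _

theorem KerModRange.mk_surjective (f : A →ₗ[R] B) (g : B →ₗ[R] C) :
    Function.Surjective (KerModRange.mk f g) := Submodule.mkQ_surjective _

theorem KerModRange.mk_eq_zero_iff {f : A →ₗ[R] B} {g : B →ₗ[R] C} (z : LinearMap.ker g) :
    KerModRange.mk f g z = 0 ↔ ∃ a, f a = z :=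
  Submodule.Quotient.mk_eq_zero _

theorem KerModRange.exists_lift {f : A →ₗ[R] B} {g : B →ₗ[R] C} (φ : B →ₗ[R] M)
    (h : ∀ a, φ (f a) = 0) :
    ∃ φ' : KerModRange f g →ₗ[R] M, ∀ z, φ' (KerModRange.mk f g z) = φ z :=
  ⟨Submodule.liftQ _ (φ ∘ₗ Submodule.subtype _) (by
    rintro ⟨x, hx⟩ ⟨a, rfl⟩
    exact h a), fun _ => rfl⟩

/-- The homology at `B` of `A → B → C`, computed by a linear map `q` on `B`. -/
theorem KerModRange.nonempty_equiv {f : A →ₗ[R] B} {g : B →ₗ[R] C} (q : B →ₗ[R] M)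
    (hqf : ∀ a, q (f a) = 0) (hker : ∀ x, g x = 0 → q x = 0 → ∃ a, f a = x)
    (hsurj : ∀ m, ∃ x, g x = 0 ∧ q x = m) : Nonempty (KerModRange f g ≃ₗ[R] M) := by
  let q' : LinearMap.ker g →ₗ[R] M := q ∘ₗ Submodule.subtype _
  have hq' : Function.Surjective q' := fun m => by
    obtain ⟨x, hx, rfl⟩ := hsurj m
    exact ⟨⟨x, hx⟩, rfl⟩
  have hk : (LinearMap.range f).submoduleOf (LinearMap.ker g) = LinearMap.ker q' := by
    ext ⟨x, hx⟩
    change x ∈ LinearMap.range f ↔ q x = 0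
    constructor
    · rintro ⟨a, rfl⟩
      exact hqf a
    · exact hker x hx
  exact ⟨(Submodule.quotEquivOfEq _ _ hk).trans (q'.quotKerEquivOfSurjective hq')⟩

/-- The homology at `B` of `A → B → C` is `M` if `M` is a deformation retract at `B`. -/
theorem KerModRange.nonempty_equiv_of_retract {f : A →ₗ[R] B} {g : B →ₗ[R] C}
    (q : B →ₗ[R] M) (i : M →ₗ[R] B) (s : B →ₗ[R] A) (t : C →ₗ[R] B)
    (hqf : q ∘ₗ f = 0) (hgi : g ∘ₗ i = 0) (hqi : q ∘ₗ i = LinearMap.id)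
    (hst : f ∘ₗ s + t ∘ₗ g = LinearMap.id - i ∘ₗ q) : Nonempty (KerModRange f g ≃ₗ[R] M) := by
  refine KerModRange.nonempty_equiv q (LinearMap.congr_fun hqf) (fun x hx hqx => ⟨s x, ?_⟩)
    fun m => ⟨i m, LinearMap.congr_fun hgi m, LinearMap.congr_fun hqi m⟩
  simpa [hx, hqx] using LinearMap.congr_fun hst x

/-- A deformation retraction dualizes. -/
theorem KerModRange.nonempty_equiv_dual_of_retract {f : A →ₗ[R] B} {g : B →ₗ[R] C}
    (q : B →ₗ[R] M) (i : M →ₗ[R] B) (s : B →ₗ[R] A) (t : C →ₗ[R] B)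
    (hqf : q ∘ₗ f = 0) (hgi : g ∘ₗ i = 0) (hqi : q ∘ₗ i = LinearMap.id)
    (hst : f ∘ₗ s + t ∘ₗ g = LinearMap.id - i ∘ₗ q) :
    Nonempty (KerModRange g.dualMap f.dualMap ≃ₗ[R] Module.Dual R M) := by
  refine KerModRange.nonempty_equiv_of_retract i.dualMap q.dualMap t.dualMap s.dualMap ?_ ?_ ?_ ?_
  · rw [LinearMap.dualMap_comp_dualMap, hgi]; ext; simp
  · rw [LinearMap.dualMap_comp_dualMap, hqf]; ext; simp
  · rw [LinearMap.dualMap_comp_dualMap, hqi]; ext; simp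
  · ext φ x
    have := congrArg φ (LinearMap.congr_fun hst x)
    simpa [add_comm] using this

end KerModRange

section Homology

variable {R : Type*} [CommRing R] {L : Type*} [LieRing L] [LieAlgebra R L]
  {M : Type*} [AddCommGroup M] [Module R M]

/-- The homology in degree `k`, computed by a linear map on the exterior algebra. -/
theorem Homology.nonempty_equiv {k : ℕ} (q : ExteriorAlgebra R L →ₗ[R] M)
    (hq : ∀ y ∈ ⋀[R]^(k + 1) L, q (totalBoundary R L y) = 0)
    (hker : ∀ z ∈ ⋀[R]^k L, totalBoundary R L z = 0 → q z = 0 →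
      ∃ y ∈ ⋀[R]^(k + 1) L, totalBoundary R L y = z)
    (hsurj : ∀ m, ∃ z ∈ ⋀[R]^k L, totalBoundary R L z = 0 ∧ q z = m) :
    Nonempty (Homology R L k ≃ₗ[R] M) := by
  refine KerModRange.nonempty_equiv (q ∘ₗ Submodule.subtype _) (fun y => ?_) (fun z hz hqz => ?_)
    fun m => ?_
  · have := hq y y.2
    rwa [← coe_boundary] at this
  · obtain ⟨y, hy, hyz⟩ := hker z z.2 (by rw [← coe_outgoing, hz]; rfl) hqz
    exact ⟨⟨y, hy⟩, Subtype.ext (by rw [coe_boundary, hyz])⟩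
  · obtain ⟨z, hz, hdz, hqz⟩ := hsurj m
    exact ⟨⟨z, hz⟩, Subtype.ext (by rw [coe_outgoing, hdz]; rfl), hqz⟩

/-- The homology and the cohomology in degree `k`, computed by a deformation retraction of the
exterior algebra. -/
theorem Homology.nonempty_equiv_of_retract {k : ℕ} (q : ExteriorAlgebra R L →ₗ[R] M)
    (i : M →ₗ[R] ExteriorAlgebra R L) (s : ExteriorAlgebra R L →ₗ[R] ExteriorAlgebra R L)
    (hi : ∀ m, i m ∈ ⋀[R]^k L) (hs : ∀ j, ∀ z ∈ ⋀[R]^j L, s z ∈ ⋀[R]^(j + 1) L)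
    (hq : ∀ z, q (totalBoundary R L z) = 0)
    (hdi : ∀ m, totalBoundary R L (i m) = 0) (hqi : ∀ m, q (i m) = m)
    (hst : ∀ z ∈ ⋀[R]^k L, totalBoundary R L (s z) + s (totalBoundary R L z) = z - i (q z)) :
    Nonempty (Homology R L k ≃ₗ[R] M) ∧
      Nonempty (Cohomology R L k ≃ₗ[R] Module.Dual R M) := by
  have hs' : ∃ t : ⋀[R]^(k - 1) L →ₗ[R] ⋀[R]^k L, ∀ z : ⋀[R]^k L,
      (t (outgoing R L k z) : ExteriorAlgebra R L) = s (totalBoundary R L z) := by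
    cases k with
    | zero => exact ⟨0, fun z => by simp [totalBoundary_of_mem_zero z.2]⟩
    | succ k =>
      refine ⟨(s ∘ₗ Submodule.subtype _).codRestrict _ fun z => hs k z z.2, fun z => ?_⟩
      rw [← coe_outgoing]
      rfl
  obtain ⟨t, ht⟩ := hs'
  let q' : ⋀[R]^k L →ₗ[R] M := q ∘ₗ Submodule.subtype _
  let i' : M →ₗ[R] ⋀[R]^k L := i.codRestrict _ hi
  let s' : ⋀[R]^k L →ₗ[R] ⋀[R]^(k + 1) L :=
    (s ∘ₗ Submodule.subtype _).codRestrict _ fun z => hs k z z.2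
  have h1 : q' ∘ₗ boundary R L k = 0 := by
    refine LinearMap.ext fun z => ?_
    have := hq z
    rwa [← coe_boundary] at this
  have h2 : outgoing R L k ∘ₗ i' = 0 := by
    refine LinearMap.ext fun m => Subtype.ext ?_
    rw [LinearMap.comp_apply, coe_outgoing]
    exact hdi m
  have h3 : q' ∘ₗ i' = LinearMap.id := LinearMap.ext hqi
  have h4 : boundary R L k ∘ₗ s' + t ∘ₗ outgoing R L k = LinearMap.id - i' ∘ₗ q' := by
    refine LinearMap.ext fun z => Subtype.ext ?_
    rw [LinearMap.add_apply, LinearMap.comp_apply, LinearMap.comp_apply, Submodule.coe_add,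
      coe_boundary, ht]
    exact hst z z.2
  exact ⟨KerModRange.nonempty_equiv_of_retract q' i' s' t h1 h2 h3 h4,
    KerModRange.nonempty_equiv_dual_of_retract q' i' s' t h1 h2 h3 h4⟩

/-- There is no `p`-torsion if every cycle `z` with `p z` a boundary is itself a boundary. -/
theorem Homology.not_hasTorsion {k p : ℕ}
    (h : ∀ z ∈ ⋀[R]^k L, totalBoundary R L z = 0 → ∀ y ∈ ⋀[R]^(k + 1) L,
      totalBoundary R L y = (p : R) • z → ∃ y ∈ ⋀[R]^(k + 1) L, totalBoundary R L y = z) :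
    ¬ HasTorsion p (Homology R L k) := by
  rintro ⟨x, hx0, hx⟩
  obtain ⟨⟨z, hz⟩, rfl⟩ := KerModRange.mk_surjective _ _ x
  refine hx0 ((KerModRange.mk_eq_zero_iff _).2 ?_)
  rw [← map_nsmul, KerModRange.mk_eq_zero_iff] at hx
  obtain ⟨y, hy⟩ := hx
  obtain ⟨y', hy', h'⟩ := h z z.2 (by rw [← coe_outgoing, LinearMap.mem_ker.1 hz]; rfl) y y.2
    (by rw [← coe_boundary, hy, Nat.cast_smul_eq_nsmul]; rfl)
  exact ⟨⟨y', hy'⟩, Subtype.ext (by rw [coe_boundary, h'])⟩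

/-- A cycle `z` with `p z` a boundary, detected by a form which is a cocycle modulo `p`, generates
a direct summand `R / p` of the homology. -/
theorem Homology.exists_class_of_order {k p : ℕ} (φ : ExteriorAlgebra R L →ₗ[R] R)
    (hφ : ∀ y ∈ ⋀[R]^(k + 1) L, (p : R) ∣ φ (totalBoundary R L y))
    {y z : ExteriorAlgebra R L} (hz : z ∈ ⋀[R]^k L) (hdz : totalBoundary R L z = 0)
    (hφz : φ z = 1) (hy : y ∈ ⋀[R]^(k + 1) L) (hdy : totalBoundary R L y = (p : R) • z) :
    ∃ (f : Homology R L k →ₗ[R] R ⧸ Ideal.span {(p : R)}) (x : Homology R L k),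
      p • x = 0 ∧ f x = 1 := by
  obtain ⟨f, hf⟩ := KerModRange.exists_lift (f := boundary R L k) (g := outgoing R L k)
      ((Ideal.span {(p : R)}).mkQ ∘ₗ φ ∘ₗ Submodule.subtype _) <| by
    intro y
    have := hφ y y.2
    rw [← coe_boundary, ← Ideal.mem_span_singleton] at this
    exact (Submodule.Quotient.mk_eq_zero _).2 this
  refine ⟨f, KerModRange.mk _ _ ⟨⟨z, hz⟩, Subtype.ext (by rw [coe_outgoing, hdz]; rfl)⟩, ?_, ?_⟩
  · rw [← map_nsmul, KerModRange.mk_eq_zero_iff]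
    refine ⟨⟨y, hy⟩, Subtype.ext ?_⟩
    rw [coe_boundary, hdy, Nat.cast_smul_eq_nsmul]
    rfl
  · rw [hf]
    change (Ideal.span {(p : R)}).mkQ (φ z) = 1
    rw [hφz]
    rfl

open Module

variable {I : Type*} [Fintype I] [LinearOrder I] (b : Basis I R L)

/-- The homology and the cohomology in degree `k`, if the exterior algebra contracts onto the span
of the basis elements at the sets which satisfy `P`, and if the differential of this span is zero:
these elements are cycles, and boundaries have no component along them. -/
theorem Homology.nonempty_equiv_of_diagonal {k : ℕ} {P : Finset I → Prop} [DecidablePred P]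
    (E : ({S : Finset I // S.card = k ∧ P S} → R) ≃ₗ[R] M)
    (s : ExteriorAlgebra R L →ₗ[R] ExteriorAlgebra R L)
    (hs : ∀ j, ∀ z ∈ ⋀[R]^j L, s z ∈ ⋀[R]^(j + 1) L)
    (hst : ∀ z, totalBoundary R L (s z) + s (totalBoundary R L z) =
      z - diagonal b (fun S => if P S then 1 else 0) z)
    (hP : ∀ S, P S → totalBoundary R L (b.ExteriorAlgebra S) = 0)
    (hP' : ∀ S, P S → ∀ z, b.ExteriorAlgebra.repr (totalBoundary R L z) S = 0) :
    Nonempty (Homology R L k ≃ₗ[R] M) ∧ Nonempty (Cohomology R L k ≃ₗ[R] M) := by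
  classical
  let J := {S : Finset I // S.card = k ∧ P S}
  let q : ExteriorAlgebra R L →ₗ[R] (J → R) := LinearMap.pi fun S => b.ExteriorAlgebra.coord S.1
  let i : (J → R) →ₗ[R] ExteriorAlgebra R L :=
    Fintype.linearCombination R fun S : J => b.ExteriorAlgebra S.1
  have hi : ∀ m, i m = ∑ S : J, m S • b.ExteriorAlgebra S.1 := fun m =>
    Fintype.linearCombination_apply R _ m
  have hrepr : ∀ m T, b.ExteriorAlgebra.repr (i m) T =
      if h : T.card = k ∧ P T then m ⟨T, h⟩ else 0 := by
    intro m T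
    rw [hi, map_sum, Finsupp.finsetSum_apply]
    split_ifs with h
    · rw [Finset.sum_eq_single_of_mem ⟨T, h⟩ (Finset.mem_univ _)]
      · simp
      · intro S _ hS
        have : S.1 ≠ T := fun h' => hS (Subtype.ext h')
        simp [this]
    · refine Finset.sum_eq_zero fun S _ => ?_
      have : S.1 ≠ T := fun h' => h (h' ▸ S.2)
      simp [this]
  suffices h : Nonempty (Homology R L k ≃ₗ[R] (J → R)) ∧
      Nonempty (Cohomology R L k ≃ₗ[R] Module.Dual R (J → R)) from
    ⟨h.1.map (·.trans E),
      h.2.map fun e => (e.trans (Pi.basisFun R J).toDualEquiv.symm).trans E⟩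
  refine Homology.nonempty_equiv_of_retract q i s ?_ hs
    (fun z => funext fun S => hP' S.1 S.2.2 z) ?_
    (fun m => funext fun S => (hrepr m S.1).trans (dif_pos S.2)) ?_
  · intro m
    refine (mem_exteriorPower_iff b).2 fun T hT => ?_
    by_contra h
    exact hT ((hrepr m T).trans (dif_neg fun h' => h h'.1))
  · intro m
    rw [hi, map_sum]
    exact Finset.sum_eq_zero fun S _ => by rw [map_smul, hP S.1 S.2.2, smul_zero]
  · intro z hz
    rw [hst]
    congr 1
    refine b.ExteriorAlgebra.repr.injective (Finsupp.ext fun T => ?_)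
    rw [hrepr, repr_diagonal]
    by_cases hT : P T
    · by_cases hc : T.card = k
      · rw [if_pos hT, one_mul, dif_pos ⟨hc, hT⟩]
        rfl
      · rw [dif_neg fun h => hc h.1, if_pos hT, one_mul]
        by_contra hne
        exact hc ((mem_exteriorPower_iff b).1 hz T hne)
    · rw [dif_neg fun h => hT h.2, if_neg hT, zero_mul]

/-- The homology in degree `k` is free on the classes of cycles `c j` with a dual family of
cocycles `φ j`, if the exterior algebra contracts onto the span of the basis elements at the sets
which satisfy `P`, and if these are homologous to combinations of the cycles. -/
theorem Homology.nonempty_equiv_of_dual {J : Type*} [Fintype J] [DecidableEq J] {k : ℕ}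
    {P : Finset I → Prop} [DecidablePred P] (E : (J → R) ≃ₗ[R] M) (s : ExteriorAlgebra R L →ₗ[R] ExteriorAlgebra R L)
    (hs : ∀ j, ∀ z ∈ ⋀[R]^j L, s z ∈ ⋀[R]^(j + 1) L)
    (hst : ∀ z, totalBoundary R L (s z) + s (totalBoundary R L z) =
      z - diagonal b (fun S => if P S then 1 else 0) z)
    (c : J → ExteriorAlgebra R L) (φ : J → ExteriorAlgebra R L →ₗ[R] R)
    (hc : ∀ j, c j ∈ ⋀[R]^k L) (hdc : ∀ j, totalBoundary R L (c j) = 0)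
    (hφ : ∀ j, ∀ y ∈ ⋀[R]^(k + 1) L, φ j (totalBoundary R L y) = 0)
    (hφc : ∀ i j, φ i (c j) = if i = j then 1 else 0)
    (hP : ∀ S : Finset I, S.card = k → P S → b.ExteriorAlgebra S -
      ∑ j, φ j (b.ExteriorAlgebra S) • c j ∈ (⋀[R]^(k + 1) L).map (totalBoundary R L))
    (hP' : ∀ S, ¬ P S → ∀ j, φ j (b.ExteriorAlgebra S) = 0) :
    Nonempty (Homology R L k ≃ₗ[R] M) := by
  suffices h : Nonempty (Homology R L k ≃ₗ[R] (J → R)) from h.map (·.trans E)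
  refine Homology.nonempty_equiv (LinearMap.pi φ) (fun y hy => funext fun j => hφ j y hy)
    (fun z hz hdz hφz => ?_) fun m => ⟨∑ j, m j • c j,
      sum_mem fun j _ => Submodule.smul_mem _ _ (hc j), ?_, funext fun i => ?_⟩
  · have hmem : diagonal b (fun S => if P S then 1 else 0) z - ∑ j, φ j z • c j ∈
        (⋀[R]^(k + 1) L).map (totalBoundary R L) := by
      let ψ : ExteriorAlgebra R L →ₗ[R] ExteriorAlgebra R L :=
        diagonal b (fun S => if P S then 1 else 0) - ∑ j, (φ j).smulRight (c j)
      have hψ : ∀ z, ψ z = diagonal b (fun S => if P S then 1 else 0) z - ∑ j, φ j z • c j :=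
        fun z => by simp [ψ]
      rw [← hψ, ← b.ExteriorAlgebra.sum_repr z, map_sum]
      refine sum_mem fun S _ => ?_
      rw [map_smul]
      by_cases hS : b.ExteriorAlgebra.repr z S = 0
      · rw [hS, zero_smul]
        exact zero_mem _
      refine Submodule.smul_mem _ _ ?_
      rw [hψ, diagonal_basis]
      by_cases h : P S
      · rw [if_pos h, one_smul]
        exact hP S ((mem_exteriorPower_iff b).1 hz S hS) h
      · simp [h, hP' S h]
    have h0 : ∀ j, φ j z = 0 := congrFun hφz
    simp only [h0, zero_smul, Finset.sum_const_zero, sub_zero] at hmem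
    obtain ⟨y, hy, hyz⟩ := hmem
    refine ⟨s z + y, add_mem (hs k z hz) hy, ?_⟩
    have := hst z
    rw [hdz, map_zero, add_zero] at this
    rw [map_add, this, hyz, sub_add_cancel]
  · rw [map_sum]
    exact Finset.sum_eq_zero fun j _ => by rw [map_smul, hdc, smul_zero]
  · simp [hφc]

end Homology

end ChevalleyEilenberg

/-! ### The standard basis of the upper triangular matrices -/

section SolBasis

open Module ChevalleyEilenberg

/-- The positions `(i, j)` with `i ≤ j`, which index the standard basis of `sol_n`. -/
def UpperIndex (n : ℕ) : Type := {x : Fin n × Fin n // x.1 ≤ x.2}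

namespace UpperIndex

variable {n : ℕ}

instance : Fintype (UpperIndex n) := inferInstanceAs (Fintype {x : Fin n × Fin n // x.1 ≤ x.2})

instance : LinearOrder (UpperIndex n) :=
  LinearOrder.lift' (fun x => toLex x.1) fun _ _ h => Subtype.ext (toLex.injective h)

/-- The row of a position. -/
def row (x : UpperIndex n) : Fin n := x.1.1

/-- The column of a position. -/
def col (x : UpperIndex n) : Fin n := x.1.2

theorem row_le_col (x : UpperIndex n) : x.row ≤ x.col := x.2

@[ext]
theorem ext {x y : UpperIndex n} (h₁ : x.row = y.row) (h₂ : x.col = y.col) : x = y :=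
  Subtype.ext (Prod.ext h₁ h₂)

/-- The weight `ε_i - ε_j` of the position `(i, j)` under the torus of diagonal matrices. -/
def weight (x : UpperIndex n) : Fin n → ℤ := Pi.single x.row 1 - Pi.single x.col 1

/-- The position `(i, j)`, for `i ≤ j`. -/
def mk (i j : Fin n) (h : i ≤ j) : UpperIndex n := ⟨(i, j), h⟩

@[simp] theorem row_mk (i j : Fin n) (h : i ≤ j) : (mk i j h).row = i := rfl

@[simp] theorem col_mk (i j : Fin n) (h : i ≤ j) : (mk i j h).col = j := rfl

theorem weight_apply (x : UpperIndex n) (a : Fin n) :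
    x.weight a = (if x.row = a then 1 else 0) - (if x.col = a then 1 else 0) := by
  simp [weight, Pi.single_apply, eq_comm]

end UpperIndex

variable (R : Type*) [CommRing R] (n : ℕ)

/-- The standard basis of `sol_n`, consisting of the matrix units. -/
def solBasis : Basis (UpperIndex n) R (sol R n) :=
  Basis.ofEquivFun
    { toFun := fun a x => a.1 x.row x.col
      invFun := fun f => ⟨Matrix.of fun i j => if h : i ≤ j then f (UpperIndex.mk i j h) else 0,
        (mem_sol_iff R n _).2 fun i j h => by simp [h]⟩
      map_add' := fun _ _ => rfl
      map_smul' := fun _ _ => rfl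
      left_inv := fun a => by
        ext i j
        by_cases h : i ≤ j
        · simp [h]
        · simpa [h] using ((mem_sol_iff R n a.1).1 a.2 i j h).symm
      right_inv := fun f => by
        ext x
        simp [x.row_le_col]
        rfl }

theorem coe_solBasis (x : UpperIndex n) :
    (solBasis R n x : Matrix (Fin n) (Fin n) R) = Matrix.single x.row x.col 1 := by
  ext i j
  simp only [solBasis, Basis.coe_ofEquivFun, LinearEquiv.coe_symm_mk', Matrix.single_apply,
    Pi.single_apply]
  by_cases h : i ≤ j
  · have : UpperIndex.mk i j h = x ↔ x.row = i ∧ x.col = j := by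
      rw [UpperIndex.ext_iff]; simp [eq_comm]
    simp [h, this]
  · have : ¬ (x.row = i ∧ x.col = j) := by
      rintro ⟨rfl, rfl⟩; exact h x.row_le_col
    simp [h, this]

variable {n}

/-- The matrix unit at the position `(i, j)` as an element of `sol_n`; it is `0` unless `i ≤ j`. -/
def solUnit (i j : Fin n) : sol R n :=
  if h : i ≤ j then solBasis R n (UpperIndex.mk i j h) else 0

theorem solUnit_of_le {i j : Fin n} (h : i ≤ j) :
    solUnit R i j = solBasis R n (UpperIndex.mk i j h) := dif_pos h

theorem solBasis_eq_solUnit (x : UpperIndex n) : solBasis R n x = solUnit R x.row x.col :=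
  (solUnit_of_le R x.row_le_col).symm

theorem coe_solUnit_of_le {i j : Fin n} (h : i ≤ j) :
    (solUnit R i j : Matrix (Fin n) (Fin n) R) = Matrix.single i j 1 := by
  rw [solUnit_of_le R h, coe_solBasis]
  rfl

theorem lie_solUnit {i j k l : Fin n} (hij : i ≤ j) (hkl : k ≤ l) :
    ⁅solUnit R i j, solUnit R k l⁆ =
      (if j = k then solUnit R i l else 0) - (if l = i then solUnit R k j else 0) := by
  refine Subtype.ext ?_
  have h : ((⁅solUnit R i j, solUnit R k l⁆ : sol R n) : Matrix (Fin n) (Fin n) R) =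
      (solUnit R i j : Matrix (Fin n) (Fin n) R) * solUnit R k l -
      (solUnit R k l : Matrix (Fin n) (Fin n) R) * solUnit R i j := rfl
  rw [h, coe_solUnit_of_le R hij, coe_solUnit_of_le R hkl, AddSubgroupClass.coe_sub]
  congr 1
  · split_ifs with h
    · subst h
      rw [coe_solUnit_of_le R (hij.trans hkl), Matrix.single_mul_single_same, one_mul]
    · rw [Matrix.single_mul_single_of_ne _ _ _ _ h]; rfl
  · split_ifs with h
    · subst h
      rw [coe_solUnit_of_le R (hkl.trans hij), Matrix.single_mul_single_same, one_mul]
    · rw [Matrix.single_mul_single_of_ne _ _ _ _ h]; rfl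

theorem lie_solBasis_mem_span (x y : UpperIndex n) :
    ⁅solBasis R n x, solBasis R n y⁆ ∈ Submodule.span R
      (solBasis R n '' {z | z.weight = x.weight + y.weight}) := by
  rw [solBasis_eq_solUnit, solBasis_eq_solUnit, lie_solUnit R x.row_le_col y.row_le_col]
  refine sub_mem ?_ ?_
  · split_ifs with h
    · rw [solUnit_of_le R (x.row_le_col.trans (h ▸ y.row_le_col))]
      refine Submodule.subset_span ⟨_, ?_, rfl⟩
      simp [UpperIndex.weight, h]
    · exact zero_mem _
  · split_ifs with h
    · rw [solUnit_of_le R (y.row_le_col.trans (h ▸ x.row_le_col))]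
      refine Submodule.subset_span ⟨_, ?_, rfl⟩
      simp [UpperIndex.weight, h]
    · exact zero_mem _

theorem lie_solUnit_diag (a : Fin n) (x : UpperIndex n) :
    ⁅solUnit R a a, solBasis R n x⁆ = (x.weight a : R) • solBasis R n x := by
  rw [solBasis_eq_solUnit, lie_solUnit R le_rfl x.row_le_col, UpperIndex.weight_apply]
  by_cases h1 : x.row = a <;> by_cases h2 : x.col = a <;>
    simp [h1, h2, eq_comm (a := a)]

end SolBasis

/-! ### Sets of roots of weight divisible by `p` -/

namespace UpperIndex

variable {n : ℕ}

theorem sum_weight_apply (T : Finset (UpperIndex n)) (a : Fin n) :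
    (∑ x ∈ T, x.weight) a = ((T.filter fun x => x.row = a).card : ℤ) -
      (T.filter fun x => x.col = a).card := by
  simp [Finset.sum_apply, weight_apply, Finset.sum_sub_distrib]

theorem weight_mk_apply (i j : Fin n) (h : i ≤ j) (a : Fin n) :
    (mk i j h).weight a = (if i = a then 1 else 0) - (if j = a then 1 else 0) :=
  weight_apply _ _

theorem sum_weight_filter_row_lt_col (S : Finset (UpperIndex n)) :
    ∑ x ∈ S.filter (fun x => x.row < x.col), x.weight = ∑ x ∈ S, x.weight := by
  refine Finset.sum_filter_of_ne fun x _ hx => lt_of_le_of_ne x.row_le_col fun h => hx ?_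
  simp [weight, h]

/-- In a nonempty set of positive roots whose weight is divisible by `p`, at least `p` roots start
at the least index that occurs, and at least `p` roots end at the greatest one. -/
theorem exists_extremal {p : ℕ} {T : Finset (UpperIndex n)} (hT : T.Nonempty)
    (hlt : ∀ x ∈ T, x.row < x.col) (hp : ∀ a, (p : ℤ) ∣ (∑ x ∈ T, x.weight) a) :
    ∃ i j, (∀ x ∈ T, i ≤ x.row) ∧ (∀ x ∈ T, x.col ≤ j) ∧
      p ≤ (T.filter fun x => x.row = i).card ∧ p ≤ (T.filter fun x => x.col = j).card ∧
      0 < (∑ x ∈ T, x.weight) i ∧ (∑ x ∈ T, x.weight) j < 0 := by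
  obtain ⟨x, hx, hmin⟩ := T.exists_min_image row hT
  obtain ⟨y, hy, hmax⟩ := T.exists_max_image col hT
  -- no root ends at the least index or starts at the greatest one, so the coordinates of the
  -- weight there are, up to sign, positive numbers of roots
  have h1 : (T.filter fun z => z.col = x.row).card = 0 := by
    rw [Finset.card_eq_zero, Finset.filter_eq_empty_iff]
    intro z hz h
    exact absurd (hmin z hz) (by rw [← h]; exact not_le.2 (hlt z hz))
  have h2 : (T.filter fun z => z.row = y.col).card = 0 := by
    rw [Finset.card_eq_zero, Finset.filter_eq_empty_iff]
    intro z hz h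
    exact absurd (hmax z hz) (by rw [← h]; exact not_le.2 (hlt z hz))
  have h3 : 0 < (T.filter fun z => z.row = x.row).card :=
    Finset.card_pos.2 ⟨x, by simp [hx]⟩
  have h4 : 0 < (T.filter fun z => z.col = y.col).card :=
    Finset.card_pos.2 ⟨y, by simp [hy]⟩
  have hx' := hp x.row
  have hy' := hp y.col
  rw [sum_weight_apply, h1, Nat.cast_zero, sub_zero, Int.natCast_dvd_natCast] at hx'
  rw [sum_weight_apply, h2, Nat.cast_zero, zero_sub, dvd_neg, Int.natCast_dvd_natCast] at hy'
  refine ⟨x.row, y.col, hmin, hmax, Nat.le_of_dvd h3 hx', Nat.le_of_dvd h4 hy', ?_, ?_⟩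
  · rw [sum_weight_apply, h1]; simpa using h3
  · rw [sum_weight_apply, h2]; simpa using h4

theorem filter_inter_filter_subset (T : Finset (UpperIndex n)) (i j : Fin n) (h : i ≤ j) :
    (T.filter fun x => x.row = i) ∩ (T.filter fun x => x.col = j) ⊆ {mk i j h} := by
  intro x hx
  simp only [Finset.mem_inter, Finset.mem_filter] at hx
  rw [Finset.mem_singleton]
  exact UpperIndex.ext hx.1.2 hx.2.2

theorem card_filter_row_add_le {T : Finset (UpperIndex n)} {i : Fin n}
    (hlt : ∀ x ∈ T, x.row < x.col) : (T.filter fun x => x.row = i).card + i + 1 ≤ n := by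
  have : (T.filter fun x => x.row = i).card ≤ (Finset.Ioi i).card := by
    refine Finset.card_le_card_of_injOn col (fun x hx => ?_) fun x hx y hy h => ?_
    · simp only [Finset.coe_filter, Set.mem_ofPred_eq] at hx
      simpa [← hx.2] using hlt x hx.1
    · simp only [Finset.coe_filter, Set.mem_ofPred_eq] at hx hy
      exact UpperIndex.ext (hx.2.trans hy.2.symm) h
  rw [Fin.card_Ioi] at this
  omega

theorem card_filter_col_le {T : Finset (UpperIndex n)} {j : Fin n}
    (hlt : ∀ x ∈ T, x.row < x.col) : (T.filter fun x => x.col = j).card ≤ j := by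
  have : (T.filter fun x => x.col = j).card ≤ (Finset.Iio j).card := by
    refine Finset.card_le_card_of_injOn row (fun x hx => ?_) fun x hx y hy h => ?_
    · simp only [Finset.coe_filter, Set.mem_ofPred_eq] at hx
      simpa [← hx.2] using hlt x hx.1
    · simp only [Finset.coe_filter, Set.mem_ofPred_eq] at hx hy
      exact UpperIndex.ext h (hx.2.trans hy.2.symm)
  rwa [Fin.card_Iio] at this

/-- There are at most `n - 1` roots which start at a given index. -/
theorem lt_of_weight_dvd {p : ℕ} {T : Finset (UpperIndex n)} (hT : T.Nonempty)
    (hlt : ∀ x ∈ T, x.row < x.col) (hp : ∀ a, (p : ℤ) ∣ (∑ x ∈ T, x.weight) a) : p < n := by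
  obtain ⟨i, j, -, -, h, -⟩ := exists_extremal hT hlt hp
  have := card_filter_row_add_le (i := i) hlt
  omega

theorem extremal_le {p : ℕ} (hp0 : 0 < p) {T : Finset (UpperIndex n)} {i j : Fin n}
    (hi : ∀ x ∈ T, i ≤ x.row) (hj : ∀ x ∈ T, x.col ≤ j)
    (hip : p ≤ (T.filter fun x => x.row = i).card) : i ≤ j := by
  obtain ⟨x, hx⟩ := Finset.card_pos.1 (hp0.trans_le hip)
  rw [Finset.mem_filter] at hx
  exact (hi x hx.1).trans (x.row_le_col.trans (hj x hx.1))

/-- Only the root `i → j` belongs both to the `p` roots which start at `i` and to the `p` roots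
which end at `j`, where `i` and `j` are the extremal indices. -/
theorem le_card_of_weight_dvd {p : ℕ} (hp0 : 0 < p) {T : Finset (UpperIndex n)} (hT : T.Nonempty)
    (hlt : ∀ x ∈ T, x.row < x.col) (hp : ∀ a, (p : ℤ) ∣ (∑ x ∈ T, x.weight) a) :
    2 * p ≤ T.card + 1 := by
  obtain ⟨i, j, hi, hj, hip, hjp, -⟩ := exists_extremal hT hlt hp
  have hij := extremal_le hp0 hi hj hip
  have h1 := Finset.card_union_add_card_inter (T.filter fun x => x.row = i)
    (T.filter fun x => x.col = j)
  have h2 := Finset.card_le_card (filter_inter_filter_subset T i j hij)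
  have h3 : ((T.filter fun x => x.row = i) ∪ (T.filter fun x => x.col = j)).card ≤ T.card :=
    Finset.card_le_card (Finset.union_subset (Finset.filter_subset _ _) (Finset.filter_subset _ _))
  rw [Finset.card_singleton] at h2
  omega

/-- The positions `(i, v)` and `(v, j)` with `v ∈ V`: the union of the paths `i → v → j`. -/
def pathSet (i j : Fin n) (V : Finset (Fin n)) : Finset (UpperIndex n) :=
  Finset.univ.filter fun x => (x.row = i ∧ x.col ∈ V) ∨ (x.row ∈ V ∧ x.col = j)

theorem mem_pathSet {i j : Fin n} {V : Finset (Fin n)} {x : UpperIndex n} :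
    x ∈ pathSet i j V ↔ (x.row = i ∧ x.col ∈ V) ∨ (x.row ∈ V ∧ x.col = j) := by
  simp [pathSet]

theorem pathSet_insert {i j v : Fin n} (V : Finset (Fin n)) (hiv : i ≤ v) (hvj : v ≤ j) :
    pathSet i j (insert v V) = insert (mk i v hiv) (insert (mk v j hvj) (pathSet i j V)) := by
  ext x
  simp only [mem_pathSet, Finset.mem_insert, UpperIndex.ext_iff, row_mk, col_mk]
  tauto

theorem pathSet_empty (i j : Fin n) : pathSet i j ∅ = ∅ := by
  ext x
  simp [mem_pathSet]

theorem mk_row_notMem_pathSet {i j v : Fin n} {V : Finset (Fin n)} (hv : v ∉ V)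
    (hiv : i ≤ v) (hV : V ⊆ Finset.Ioo i j) : mk i v hiv ∉ pathSet i j V := by
  rw [mem_pathSet, row_mk, col_mk]
  rintro (⟨_, h⟩ | ⟨h, _⟩)
  · exact hv h
  · exact absurd (Finset.mem_Ioo.1 (hV h)).1 (lt_irrefl i)

theorem mk_col_notMem_pathSet {i j v : Fin n} {V : Finset (Fin n)} (hv : v ∉ V)
    (hvj : v ≤ j) (hV : V ⊆ Finset.Ioo i j) : mk v j hvj ∉ pathSet i j V := by
  rw [mem_pathSet, row_mk, col_mk]
  rintro (⟨_, h⟩ | ⟨h, _⟩)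
  · exact absurd (Finset.mem_Ioo.1 (hV h)).2 (lt_irrefl j)
  · exact hv h

theorem mk_notMem_insert_pathSet {i j v : Fin n} {V : Finset (Fin n)} (hv : v ∉ V)
    (hiv : i < v) (hvj : v < j) (hV : V ⊆ Finset.Ioo i j) :
    mk i v hiv.le ∉ insert (mk v j hvj.le) (pathSet i j V) := by
  rw [Finset.mem_insert]
  rintro (h | h)
  · exact hiv.ne (congrArg row h)
  · exact mk_row_notMem_pathSet hv hiv.le hV h

/-- The weight of `pathSet i j V` is `#V (ε_i - ε_j)`. -/
theorem sum_weight_pathSet {i j : Fin n} {V : Finset (Fin n)} (hV : V ⊆ Finset.Ioo i j) :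
    ∑ x ∈ pathSet i j V, x.weight = V.card • (Pi.single i 1 - Pi.single j 1) := by
  induction V using Finset.induction_on with
  | empty => simp [pathSet_empty]
  | insert v V hv ih =>
    rw [Finset.insert_subset_iff, Finset.mem_Ioo] at hV
    rw [pathSet_insert V hV.1.1.le hV.1.2.le, Finset.sum_insert
      (mk_notMem_insert_pathSet hv hV.1.1 hV.1.2 hV.2), Finset.sum_insert
      (mk_col_notMem_pathSet hv hV.1.2.le hV.2), ih hV.2, Finset.card_insert_of_notMem hv]
    simp only [weight, row_mk, col_mk]
    rw [succ_nsmul]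
    abel

theorem card_pathSet {i j : Fin n} {V : Finset (Fin n)} (hV : V ⊆ Finset.Ioo i j) :
    (pathSet i j V).card = 2 * V.card := by
  induction V using Finset.induction_on with
  | empty => simp [pathSet_empty]
  | insert v V hv ih =>
    rw [Finset.insert_subset_iff, Finset.mem_Ioo] at hV
    rw [pathSet_insert V hV.1.1.le hV.1.2.le, Finset.card_insert_of_notMem
      (mk_notMem_insert_pathSet hv hV.1.1 hV.1.2 hV.2), Finset.card_insert_of_notMem
      (mk_col_notMem_pathSet hv hV.1.2.le hV.2), ih hV.2, Finset.card_insert_of_notMem hv]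
    ring

theorem mk_notMem_pathSet {i j : Fin n} (hij : i ≤ j) {V : Finset (Fin n)}
    (hV : V ⊆ Finset.Ioo i j) : mk i j hij ∉ pathSet i j V :=
  mk_row_notMem_pathSet (fun h => absurd (Finset.mem_Ioo.1 (hV h)).2 (lt_irrefl j)) hij hV

/-- If all roots in `T` start at `i` or end at `j`, and the weight is divisible by `p ≥ 2`
elsewhere, then `T` consists of paths `i → v → j`, and possibly of `i → j`. -/
theorem exists_erase_eq_pathSet {p : ℕ} (hp2 : 2 ≤ p) {T : Finset (UpperIndex n)} {i j : Fin n}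
    (hij : i ≤ j) (hlt : ∀ x ∈ T, x.row < x.col) (hi : ∀ x ∈ T, i ≤ x.row)
    (hj : ∀ x ∈ T, x.col ≤ j)
    (hp : ∀ a, a ≠ i → a ≠ j → (p : ℤ) ∣ (∑ x ∈ T, x.weight) a)
    (hor : ∀ x ∈ T, x.row = i ∨ x.col = j) :
    ∃ V ⊆ Finset.Ioo i j, T.erase (mk i j hij) = pathSet i j V := by
  -- at an interior vertex there is at most one root of each kind, so divisibility by `p ≥ 2`
  -- forces balance
  have hbal : ∀ v, ∀ hiv : i < v, ∀ hvj : v < j, mk i v hiv.le ∈ T ↔ mk v j hvj.le ∈ T := by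
    intro v hiv hvj
    have h1 : (T.filter fun x => x.row = v) = if mk v j hvj.le ∈ T then {mk v j hvj.le} else ∅ := by
      ext x
      have : x.row = v ∧ x ∈ T → x = mk v j hvj.le := fun h =>
        UpperIndex.ext h.1 ((hor x h.2).resolve_left fun h' => hiv.ne (h'.symm.trans h.1))
      split_ifs with h
      · rw [Finset.mem_filter, Finset.mem_singleton]
        exact ⟨fun h => this h.symm, fun h' => h' ▸ ⟨h, rfl⟩⟩
      · simp only [Finset.mem_filter, Finset.notMem_empty, iff_false]
        exact fun h' => h (this h'.symm ▸ h'.1)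
    have h2 : (T.filter fun x => x.col = v) = if mk i v hiv.le ∈ T then {mk i v hiv.le} else ∅ := by
      ext x
      have : x.col = v ∧ x ∈ T → x = mk i v hiv.le := fun h =>
        UpperIndex.ext ((hor x h.2).resolve_right fun h' => hvj.ne (h.1.symm.trans h')) h.1
      split_ifs with h
      · rw [Finset.mem_filter, Finset.mem_singleton]
        exact ⟨fun h => this h.symm, fun h' => h' ▸ ⟨h, rfl⟩⟩
      · simp only [Finset.mem_filter, Finset.notMem_empty, iff_false]
        exact fun h' => h (this h'.symm ▸ h'.1)
    have h3 := hp v hiv.ne' hvj.ne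
    rw [sum_weight_apply, h1, h2] at h3
    have hp1 : ¬ (p : ℤ) ∣ 1 := fun h => by
      have := Int.le_of_dvd one_pos h
      omega
    by_cases h4 : mk i v hiv.le ∈ T <;> by_cases h5 : mk v j hvj.le ∈ T <;>
      simp_all
  refine ⟨(Finset.Ioo i j).filter fun v => ∃ h : i ≤ v, mk i v h ∈ T, Finset.filter_subset _ _, ?_⟩
  ext x
  rw [Finset.mem_erase, mem_pathSet, Finset.mem_filter, Finset.mem_filter, Finset.mem_Ioo,
    Finset.mem_Ioo]
  constructor
  · rintro ⟨hx, hxT⟩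
    rcases hor x hxT with h | h
    · refine Or.inl ⟨h, ⟨h ▸ hlt x hxT, lt_of_le_of_ne (hj x hxT) fun h' =>
        hx (UpperIndex.ext h h')⟩, h ▸ x.row_le_col, ?_⟩
      convert hxT
      exact UpperIndex.ext h.symm rfl
    · have h1 : i < x.row := lt_of_le_of_ne (hi x hxT) fun h' =>
        hx (UpperIndex.ext h'.symm h)
      have h2 : x.row < j := h ▸ hlt x hxT
      refine Or.inr ⟨⟨⟨h1, h2⟩, h1.le, (hbal _ h1 h2).2 ?_⟩, h⟩
      convert hxT
      exact UpperIndex.ext rfl h.symm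
  · rintro (⟨h, ⟨h1, h2⟩, h3, h4⟩ | ⟨⟨⟨h1, h2⟩, h3, h4⟩, h⟩)
    · refine ⟨fun h' => h2.ne (congrArg col h'), ?_⟩
      convert h4
      exact UpperIndex.ext h rfl
    · refine ⟨fun h' => h1.ne' (congrArg row h'), ?_⟩
      convert (hbal _ h1 h2).1 h4
      exact UpperIndex.ext rfl h

/-- A set of `2p - 1` roots of nonzero weight divisible by `p` consists of `i → j` and of `p - 1`
paths `i → v → j`. -/
theorem exists_eq_insert_pathSet {p : ℕ} (hp2 : 2 ≤ p) {T : Finset (UpperIndex n)}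
    (hcard : T.card = 2 * p - 1)
    (hlt : ∀ x ∈ T, x.row < x.col) (hp : ∀ a, (p : ℤ) ∣ (∑ x ∈ T, x.weight) a) :
    ∃ i j, ∃ hij : i < j, ∃ V ∈ (Finset.Ioo i j).powersetCard (p - 1),
      T = insert (mk i j hij.le) (pathSet i j V) := by
  have hT : T.Nonempty := Finset.card_pos.1 (by omega)
  obtain ⟨i, j, hi, hj, hip, hjp, -⟩ := exists_extremal hT hlt hp
  have hij := extremal_le (by omega) hi hj hip
  have h1 := Finset.card_union_add_card_inter (T.filter fun x => x.row = i)
    (T.filter fun x => x.col = j)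
  have h2' := filter_inter_filter_subset T i j hij
  have h2 := Finset.card_le_card h2'
  have hsub : (T.filter fun x => x.row = i) ∪ (T.filter fun x => x.col = j) ⊆ T :=
    Finset.union_subset (Finset.filter_subset _ _) (Finset.filter_subset _ _)
  have h3 := Finset.card_le_card hsub
  rw [Finset.card_singleton] at h2
  have hor : ∀ x ∈ T, x.row = i ∨ x.col = j := fun x hx => by
    rw [← Finset.eq_of_subset_of_card_le hsub (by omega)] at hx
    simp only [Finset.mem_union, Finset.mem_filter] at hx
    tauto
  have hmem : mk i j hij ∈ T := by
    have : ((T.filter fun x => x.row = i) ∩ (T.filter fun x => x.col = j)).Nonempty :=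
      Finset.card_pos.1 (by omega)
    obtain ⟨x, hx⟩ := this
    rw [← Finset.mem_singleton.1 (h2' hx)]
    exact hsub (Finset.inter_subset_union hx)
  obtain ⟨V, hV, hTV⟩ := exists_erase_eq_pathSet hp2 hij hlt hi hj (fun a _ _ => hp a) hor
  have hc := Finset.card_erase_of_mem hmem
  rw [hTV, card_pathSet hV] at hc
  exact ⟨i, j, hlt _ hmem, V, Finset.mem_powersetCard.2 ⟨hV, by omega⟩, by
    rw [← hTV, Finset.insert_erase hmem]⟩

/-- The sets of `2p` roots of weight `p (ε_i - ε_j)`. -/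
theorem eq_pathSet_or_of_sum_weight {p : ℕ} (hp2 : 2 ≤ p) {T : Finset (UpperIndex n)}
    (hcard : T.card = 2 * p) (hlt : ∀ x ∈ T, x.row < x.col) {i j : Fin n} (hij : i < j)
    (hw : ∑ x ∈ T, x.weight = p • (Pi.single i 1 - Pi.single j 1)) :
    (∃ V ∈ (Finset.Ioo i j).powersetCard p, T = pathSet i j V) ∨
    ∃ u w, ∃ hiu : i < u, ∃ huw : u < w, ∃ hwj : w < j,
      ∃ V ∈ (Finset.Ioo i j).powersetCard (p - 2), u ∉ V ∧ w ∉ V ∧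
        T = insert (mk i u hiu.le) (insert (mk u w huw.le) (insert (mk w j hwj.le)
          (insert (mk i j hij.le) (pathSet i j V)))) := by
  have hT : T.Nonempty := Finset.card_pos.1 (by omega)
  have hwa : ∀ a, (∑ x ∈ T, x.weight) a = p * ((if a = i then 1 else 0) - if a = j then 1 else 0) :=
    fun a => by rw [hw]; simp [Pi.single_apply]
  obtain ⟨i', j', hi, hj, hip, hjp, hpos, hneg⟩ := exists_extremal (p := p) hT hlt
    fun a => ⟨_, hwa a⟩
  obtain rfl : i' = i := by
    rw [hwa] at hpos
    by_contra h
    rw [if_neg h] at hpos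
    split_ifs at hpos <;> simp at hpos
    omega
  obtain rfl : j' = j := by
    rw [hwa] at hneg
    by_contra h
    rw [if_neg h] at hneg
    split_ifs at hneg <;> simp at hneg
    omega
  have hbal : ∀ a, a ≠ i' → a ≠ j' → (∑ x ∈ T, x.weight) a = 0 := fun a h1 h2 => by
    simp [hwa, h1, h2]
  have h1 := Finset.card_union_add_card_inter (T.filter fun x => x.row = i')
    (T.filter fun x => x.col = j')
  have h2' := filter_inter_filter_subset T i' j' hij.le
  have h2 := Finset.card_le_card h2'
  have hsub : (T.filter fun x => x.row = i') ∪ (T.filter fun x => x.col = j') ⊆ T :=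
    Finset.union_subset (Finset.filter_subset _ _) (Finset.filter_subset _ _)
  have h3 := Finset.card_le_card hsub
  rw [Finset.card_singleton] at h2
  by_cases hor : ∀ x ∈ T, x.row = i' ∨ x.col = j'
  · obtain ⟨V, hV, hTV⟩ := exists_erase_eq_pathSet hp2 hij.le hlt hi hj
      (fun a h1 h2 => hbal a h1 h2 ▸ dvd_zero _) hor
    have hc := card_pathSet hV
    rw [← hTV] at hc
    have hmem : mk i' j' hij.le ∉ T := fun h => by
      rw [Finset.card_erase_of_mem h] at hc
      omega
    rw [Finset.erase_eq_of_notMem hmem] at hc hTV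
    exact Or.inl ⟨V, Finset.mem_powersetCard.2 ⟨hV, by omega⟩, hTV⟩
  · push Not at hor
    obtain ⟨x, hx, hxi, hxj⟩ := hor
    have hxu : x ∉ (T.filter fun x => x.row = i') ∪ (T.filter fun x => x.col = j') := by
      simp [hxi, hxj]
    have h4 := Finset.card_le_card (Finset.insert_subset hx hsub)
    rw [Finset.card_insert_of_notMem hxu] at h4
    have hT' : insert x ((T.filter fun x => x.row = i') ∪ (T.filter fun x => x.col = j')) = T :=
      Finset.eq_of_subset_of_card_le (Finset.insert_subset hx hsub)
        (by rw [Finset.card_insert_of_notMem hxu]; omega)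
    have hor : ∀ y ∈ T, y ≠ x → y.row = i' ∨ y.col = j' := fun y hy hyx => by
      rw [← hT'] at hy
      simp only [Finset.mem_insert, Finset.mem_union, Finset.mem_filter] at hy
      tauto
    have hmem : mk i' j' hij.le ∈ T := by
      obtain ⟨y, hy⟩ : ((T.filter fun x => x.row = i') ∩
        (T.filter fun x => x.col = j')).Nonempty := Finset.card_pos.1 (by omega)
      rw [← Finset.mem_singleton.1 (h2' hy)]
      exact hsub (Finset.inter_subset_union hy)
    have hxlt := hlt x hx
    have hiu : i' < x.row := lt_of_le_of_ne (hi x hx) (Ne.symm hxi)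
    have hwj : x.col < j' := lt_of_le_of_ne (hj x hx) hxj
    -- the interior vertices `x.row` and `x.col` are balanced, which yields `i' → x.row` and
    -- `x.col → j'`
    have hmu : mk i' x.row hiu.le ∈ T := by
      have h5 := hbal x.row hxi (hxlt.trans hwj).ne
      rw [sum_weight_apply] at h5
      have h6 : 0 < (T.filter fun y => y.row = x.row).card := Finset.card_pos.2 ⟨x, by simp [hx]⟩
      obtain ⟨y, hy⟩ := Finset.card_pos.1 (show 0 < (T.filter fun y => y.col = x.row).card by omega)
      rw [Finset.mem_filter] at hy
      have hyx : y ≠ x := fun h => hxlt.ne (by rw [← hy.2, h])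
      have h7 := (hor y hy.1 hyx).resolve_right fun h => (hxlt.trans hwj).ne (hy.2.symm.trans h)
      rw [show mk i' x.row hiu.le = y from UpperIndex.ext h7.symm hy.2.symm]
      exact hy.1
    have hmw : mk x.col j' hwj.le ∈ T := by
      have h5 := hbal x.col (hiu.trans hxlt).ne' hxj
      rw [sum_weight_apply] at h5
      have h6 : 0 < (T.filter fun y => y.col = x.col).card := Finset.card_pos.2 ⟨x, by simp [hx]⟩
      obtain ⟨y, hy⟩ := Finset.card_pos.1 (show 0 < (T.filter fun y => y.row = x.col).card by omega)
      rw [Finset.mem_filter] at hy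
      have hyx : y ≠ x := fun h => hxlt.ne (by rw [← hy.2, h])
      have h7 := (hor y hy.1 hyx).resolve_left fun h => (hiu.trans hxlt).ne (h.symm.trans hy.2)
      rw [show mk x.col j' hwj.le = y from UpperIndex.ext hy.2.symm h7.symm]
      exact hy.1
    -- remove the path `i' → x.row → x.col → j'`
    have hm1 : x ∈ T.erase (mk i' x.row hiu.le) :=
      Finset.mem_erase.2 ⟨fun h => hxi (congrArg row h), hx⟩
    have hm2 : mk x.col j' hwj.le ∈ (T.erase (mk i' x.row hiu.le)).erase x :=
      Finset.mem_erase.2 ⟨fun h => hxlt.ne' (congrArg row h),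
        Finset.mem_erase.2 ⟨fun h => (hiu.trans hxlt).ne' (congrArg row h), hmw⟩⟩
    have hm3 : mk i' j' hij.le ∈
        ((T.erase (mk i' x.row hiu.le)).erase x).erase (mk x.col j' hwj.le) :=
      Finset.mem_erase.2 ⟨fun h => (hiu.trans hxlt).ne (congrArg row h),
        Finset.mem_erase.2 ⟨fun h => hxi (congrArg row h).symm, Finset.mem_erase.2
          ⟨fun h => (hxlt.trans hwj).ne' (congrArg col h), hmem⟩⟩⟩
    set T' := ((T.erase (mk i' x.row hiu.le)).erase x).erase (mk x.col j' hwj.le) with hT'def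
    have hsubT : T' ⊆ T := (Finset.erase_subset _ _).trans
      ((Finset.erase_subset _ _).trans (Finset.erase_subset _ _))
    have hins : insert (mk i' x.row hiu.le) (insert x (insert (mk x.col j' hwj.le) T')) = T := by
      rw [hT'def, Finset.insert_erase hm2, Finset.insert_erase hm1, Finset.insert_erase hmu]
    have hn3 : mk x.col j' hwj.le ∉ T' := Finset.notMem_erase _ _
    have hn2 : x ∉ insert (mk x.col j' hwj.le) T' := by
      rw [hT'def, Finset.insert_erase hm2]
      exact Finset.notMem_erase _ _
    have hn1 : mk i' x.row hiu.le ∉ insert x (insert (mk x.col j' hwj.le) T') := by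
      rw [hT'def, Finset.insert_erase hm2, Finset.insert_erase hm1]
      exact Finset.notMem_erase _ _
    have hwT' : ∀ a, a ≠ i' → a ≠ j' → (∑ y ∈ T', y.weight) a = 0 := fun a h1 h2 => by
      have h5 := hbal a h1 h2
      rw [← hins, Finset.sum_insert hn1, Finset.sum_insert hn2, Finset.sum_insert hn3] at h5
      simp only [Pi.add_apply, weight_mk_apply, weight_apply x] at h5
      rw [if_neg h1.symm, if_neg h2.symm] at h5
      linarith
    obtain ⟨V, hV, hTV⟩ := exists_erase_eq_pathSet hp2 hij.le (fun y hy => hlt y (hsubT hy))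
      (fun y hy => hi y (hsubT hy)) (fun y hy => hj y (hsubT hy))
      (fun a h1 h2 => hwT' a h1 h2 ▸ dvd_zero _)
      (fun y hy => hor y (hsubT hy) fun h =>
        hn2 (Finset.mem_insert_of_mem (h ▸ hy)))
    have hT'V : T' = insert (mk i' j' hij.le) (pathSet i' j' V) := by
      rw [← hTV, Finset.insert_erase hm3]
    have hc : T.card = (pathSet i' j' V).card + 4 := by
      rw [← hins, Finset.card_insert_of_notMem hn1, Finset.card_insert_of_notMem hn2,
        Finset.card_insert_of_notMem hn3, ← Finset.card_erase_add_one hm3, hTV]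
    rw [card_pathSet hV] at hc
    refine Or.inr ⟨x.row, x.col, hiu, hxlt, hwj, V, Finset.mem_powersetCard.2 ⟨hV, by omega⟩,
      fun h => ?_, fun h => ?_, ?_⟩
    · refine hn1 (Finset.mem_insert_of_mem (Finset.mem_insert_of_mem ?_))
      rw [hT'V]
      exact Finset.mem_insert_of_mem (mem_pathSet.2 (Or.inl ⟨rfl, h⟩))
    · refine hn3 ?_
      rw [hT'V]
      exact Finset.mem_insert_of_mem (mem_pathSet.2 (Or.inr ⟨h, rfl⟩))
    · rw [← hT'V]
      exact hins.symm

/-- For `n = p + 1` there is only one nonempty set of roots of weight divisible by `p`. -/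
theorem eq_insert_pathSet_of_weight_dvd {p : ℕ} (hp0 : 0 < p)
    {T : Finset (UpperIndex (p + 1))} (hT : T.Nonempty)
    (hlt : ∀ x ∈ T, x.row < x.col) (hp : ∀ a, (p : ℤ) ∣ (∑ x ∈ T, x.weight) a) :
    T = insert (mk 0 (Fin.last p) (Fin.zero_le _))
      (pathSet 0 (Fin.last p) (Finset.Ioo 0 (Fin.last p))) := by
  set S := insert (mk 0 (Fin.last p) (Fin.zero_le _))
      (pathSet 0 (Fin.last p) (Finset.Ioo 0 (Fin.last p))) with hS
  have hlast : (0 : Fin (p + 1)) < Fin.last p := by simpa [Fin.lt_def] using hp0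
  have hmemS : ∀ x : UpperIndex (p + 1), x ∈ S ↔
      x.row < x.col ∧ (x.row = 0 ∨ x.col = Fin.last p) := by
    intro x
    rw [hS, Finset.mem_insert, mem_pathSet, Finset.mem_Ioo, Finset.mem_Ioo, UpperIndex.ext_iff,
      row_mk, col_mk]
    have h1 := Fin.le_last x.col
    have h2 := Fin.zero_le x.row
    constructor
    · rintro (⟨h, h'⟩ | ⟨h, h'⟩ | ⟨h, h'⟩) <;> simp_all
    · rintro ⟨h, h' | h'⟩
      · rcases h1.eq_or_lt with h3 | h3 <;> simp_all
      · rcases h2.eq_or_lt with h3 | h3 <;> simp_all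
  have hSw : ∀ a, (p : ℤ) ∣ (∑ x ∈ S, x.weight) a := by
    intro a
    rw [hS, Finset.sum_insert (mk_notMem_pathSet _ subset_rfl), sum_weight_pathSet subset_rfl,
      Fin.card_Ioo]
    simp only [weight, row_mk, col_mk]
    rw [← succ_nsmul', Fin.val_last, Fin.val_zero, Nat.sub_zero, Nat.sub_add_cancel hp0]
    simp
  obtain ⟨i, j, hi, hj, hip, hjp, -⟩ := exists_extremal hT hlt hp
  have hci := card_filter_row_add_le (i := i) hlt
  have hcj := card_filter_col_le (j := j) hlt
  have hi0 : i = 0 := Fin.ext (by rw [Fin.val_zero]; omega)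
  have hj0 : j = Fin.last p := Fin.ext (by have := j.2; rw [Fin.val_last]; omega)
  subst hi0 hj0
  have hST : S ⊆ T := by
    have hrow : ∀ v, 0 < v → ∃ x ∈ T, x.row = 0 ∧ x.col = v := by
      intro v hv
      have himg : (T.filter fun x => x.row = 0).image col = Finset.Ioi 0 := by
        refine Finset.eq_of_subset_of_card_le (fun v hv => ?_) ?_
        · simp only [Finset.mem_image, Finset.mem_filter] at hv
          obtain ⟨x, ⟨hx, hx0⟩, rfl⟩ := hv
          rw [Finset.mem_Ioi, ← hx0]
          exact hlt x hx
        · rw [Finset.card_image_of_injOn, Fin.card_Ioi]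
          · simpa using hip
          · intro x hx y hy h
            simp only [Finset.coe_filter, Set.mem_ofPred_eq] at hx hy
            exact UpperIndex.ext (hx.2.trans hy.2.symm) h
      have := Finset.mem_Ioi.2 hv
      rw [← himg] at this
      simp only [Finset.mem_image, Finset.mem_filter] at this
      obtain ⟨x, ⟨h1, h2⟩, h3⟩ := this
      exact ⟨x, h1, h2, h3⟩
    have hcol : ∀ v, v < Fin.last p → ∃ x ∈ T, x.row = v ∧ x.col = Fin.last p := by
      intro v hv
      have himg : (T.filter fun x => x.col = Fin.last p).image row = Finset.Iio (Fin.last p) := by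
        refine Finset.eq_of_subset_of_card_le (fun v hv => ?_) ?_
        · simp only [Finset.mem_image, Finset.mem_filter] at hv
          obtain ⟨x, ⟨hx, hx0⟩, rfl⟩ := hv
          rw [Finset.mem_Iio, ← hx0]
          exact hlt x hx
        · rw [Finset.card_image_of_injOn, Fin.card_Iio]
          · simpa using hjp
          · intro x hx y hy h
            simp only [Finset.coe_filter, Set.mem_ofPred_eq] at hx hy
            exact UpperIndex.ext h (hx.2.trans hy.2.symm)
      have := Finset.mem_Iio.2 hv
      rw [← himg] at this
      simp only [Finset.mem_image, Finset.mem_filter] at this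
      obtain ⟨x, ⟨h1, h2⟩, h3⟩ := this
      exact ⟨x, h1, h3, h2⟩
    intro x hx
    obtain ⟨h1, h2 | h2⟩ := (hmemS x).1 hx
    · obtain ⟨y, hy, hy1, hy2⟩ := hrow x.col (h2 ▸ h1)
      rwa [show x = y from UpperIndex.ext (h2.trans hy1.symm) hy2.symm]
    · obtain ⟨y, hy, hy1, hy2⟩ := hcol x.row (h2 ▸ h1)
      rwa [show x = y from UpperIndex.ext hy1.symm (h2.trans hy2.symm)]
  -- the complement has weight divisible by `p` as well, but contains no root starting at `0`
  by_contra hne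
  have hT' : (T \ S).Nonempty := by
    rw [Finset.sdiff_nonempty]
    exact fun h => hne (h.antisymm hST)
  have hlt' : ∀ x ∈ T \ S, x.row < x.col := fun x hx => hlt x (Finset.mem_sdiff.1 hx).1
  obtain ⟨i, j, -, -, hip', -⟩ := exists_extremal (p := p) hT' hlt' fun a => by
    have := Finset.sum_sdiff hST (f := weight)
    rw [← eq_sub_iff_add_eq] at this
    rw [this]
    exact dvd_sub (hp a) (hSw a)
  have hci' := card_filter_row_add_le (i := i) hlt'
  have hi0 : i = 0 := Fin.ext (by rw [Fin.val_zero]; omega)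
  obtain ⟨x, hx⟩ := Finset.card_pos.1 (hp0.trans_le hip')
  rw [Finset.mem_filter] at hx
  exact (Finset.mem_sdiff.1 hx.1).2 ((hmemS x).2 ⟨hlt' x hx.1, Or.inl (hx.2.trans hi0)⟩)

end UpperIndex

/-! ### Products of paths -/

namespace ChevalleyEilenberg

section PathProducts

open ExteriorAlgebra Module UpperIndex

theorem commute_ι_mul_ι {R : Type*} [CommRing R] {M : Type*} [AddCommGroup M] [Module R M]
    (x y z : M) : Commute (ι R x * ι R y) (ι R z) := by
  have h1 : ι R y * ι R z = -(ι R z * ι R y) := eq_neg_of_add_eq_zero_left (ι_add_mul_swap y z)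
  have h2 : ι R x * ι R z = -(ι R z * ι R x) := eq_neg_of_add_eq_zero_left (ι_add_mul_swap x z)
  rw [commute_iff_eq, mul_assoc, h1, mul_neg, ← mul_assoc, h2, neg_mul, neg_neg, mul_assoc]

variable (R : Type*) [CommRing R] {n : ℕ}

/-- The matrix unit at `(i, j)` as an element of the exterior algebra of `sol_n`. -/
abbrev unitForm (i j : Fin n) : ExteriorAlgebra R (sol R n) := ι R (solUnit R i j)

theorem pairwise_commute_unitForm (i j : Fin n) (V : Finset (Fin n)) :
    (V : Set (Fin n)).Pairwise
      (Function.onFun Commute fun v => unitForm R i v * unitForm R v j) := fun _ _ _ _ _ =>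
  (commute_ι_mul_ι _ _ _).mul_right (commute_ι_mul_ι _ _ _)

/-- The product over `v ∈ V` of the even elements `e_iv ∧ e_vj`. -/
def pathProd (i j : Fin n) (V : Finset (Fin n)) : ExteriorAlgebra R (sol R n) :=
  V.noncommProd (fun v => unitForm R i v * unitForm R v j)
    (pairwise_commute_unitForm R i j V)

/-- The product of `e_ij` and of the elements `e_iv ∧ e_vj` for `v ∈ V`. -/
def pathCycle (i j : Fin n) (V : Finset (Fin n)) : ExteriorAlgebra R (sol R n) :=
  unitForm R i j * pathProd R i j V

theorem pathProd_empty (i j : Fin n) : pathProd R i j ∅ = 1 := Finset.noncommProd_empty _ _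

theorem pathProd_insert (i j : Fin n) {v : Fin n} {V : Finset (Fin n)} (hv : v ∉ V) :
    pathProd R i j (insert v V) =
      unitForm R i v * (unitForm R v j * pathProd R i j V) := by
  rw [pathProd, Finset.noncommProd_insert_of_notMem _ _ _ _ hv, mul_assoc]
  rfl

theorem pathCycle_insert (i j : Fin n) {v : Fin n} {V : Finset (Fin n)} (hv : v ∉ V) :
    pathCycle R i j (insert v V) =
      unitForm R i v * (unitForm R v j * pathCycle R i j V) := by
  rw [pathCycle, pathProd_insert R i j hv, pathCycle, ← mul_assoc (unitForm R i v),
    ← mul_assoc (unitForm R i v), ← mul_assoc (unitForm R i j), ← mul_assoc _ (unitForm R i j),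
    (commute_ι_mul_ι _ _ _).eq]

theorem lieDer_pathProd {i j k l : Fin n} {V : Finset (Fin n)} (hV : V ⊆ Finset.Ioo i j)
    (hkl : k ≤ l) (hk : k ∉ V) (hl : l ∉ V) (hkj : k ≠ j) (hli : l ≠ i) :
    lieDer R (solUnit R k l) (pathProd R i j V) = 0 := by
  induction V using Finset.induction_on with
  | empty => rw [pathProd_empty, lieDer_one]
  | insert v V hv ih =>
    rw [Finset.insert_subset_iff, Finset.mem_Ioo] at hV
    rw [Finset.mem_insert, not_or] at hk hl
    rw [pathProd_insert R i j hv, lieDer_ι_mul, lieDer_ι_mul, ih hV.2 hk.2 hl.2,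
      lie_solUnit R hkl hV.1.1.le, lie_solUnit R hkl hV.1.2.le, if_neg hli, if_neg (Ne.symm hk.1),
      if_neg hl.1, if_neg (Ne.symm hkj)]
    simp

theorem lieDer_pathCycle {i j k l : Fin n} {V : Finset (Fin n)} (hV : V ⊆ Finset.Ioo i j)
    (hij : i ≤ j) (hkl : k ≤ l) (hk : k ∉ V) (hl : l ∉ V) (hkj : k ≠ j) (hli : l ≠ i) :
    lieDer R (solUnit R k l) (pathCycle R i j V) = 0 := by
  rw [pathCycle, lieDer_ι_mul, lieDer_pathProd R hV hkl hk hl hkj hli, lie_solUnit R hkl hij,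
    if_neg hli, if_neg (Ne.symm hkj)]
  simp

/-- The bracket `[e_iv, e_vj] = e_ij` is the only one which contributes. -/
theorem totalBoundary_pathProd {i j : Fin n} {V : Finset (Fin n)} (hV : V ⊆ Finset.Ioo i j) :
    totalBoundary R (sol R n) (pathProd R i j V) = -∑ v ∈ V, pathCycle R i j (V.erase v) := by
  induction V using Finset.induction_on with
  | empty => rw [pathProd_empty, totalBoundary_one]; simp
  | insert v V hv ih =>
    rw [Finset.insert_subset_iff, Finset.mem_Ioo] at hV
    have hi : i ∉ V := fun h => absurd (Finset.mem_Ioo.1 (hV.2 h)).1 (lt_irrefl i)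
    have hj : j ∉ V := fun h => absurd (Finset.mem_Ioo.1 (hV.2 h)).2 (lt_irrefl j)
    have hij := (hV.1.1.trans hV.1.2).ne
    rw [pathProd_insert R i j hv, totalBoundary_ι_mul, totalBoundary_ι_mul, lieDer_ι_mul,
      lieDer_pathProd R hV.2 hV.1.1.le hi hv hij hV.1.1.ne',
      lieDer_pathProd R hV.2 hV.1.2.le hv hj hV.1.2.ne hij.symm,
      lie_solUnit R hV.1.1.le hV.1.2.le, if_pos rfl, if_neg hij.symm, ih hV.2,
      Finset.sum_insert hv, Finset.erase_insert hv]
    have : ∑ v' ∈ V, pathCycle R i j ((insert v V).erase v') =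
        unitForm R i v * (unitForm R v j * ∑ v' ∈ V, pathCycle R i j (V.erase v')) := by
      rw [Finset.mul_sum, Finset.mul_sum]
      refine Finset.sum_congr rfl fun v' hv' => ?_
      rw [Finset.erase_insert_of_ne (by rintro rfl; exact hv hv'), pathCycle_insert]
      exact fun h => hv (Finset.mem_of_mem_erase h)
    rw [this, pathCycle]
    simp only [mul_neg, neg_neg, sub_zero, mul_zero, add_zero]
    abel

theorem totalBoundary_pathCycle {i j : Fin n} {V : Finset (Fin n)} (hij : i < j)
    (hV : V ⊆ Finset.Ioo i j) : totalBoundary R (sol R n) (pathCycle R i j V) = 0 := by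
  have hi : i ∉ V := fun h => absurd (Finset.mem_Ioo.1 (hV h)).1 (lt_irrefl i)
  have hj : j ∉ V := fun h => absurd (Finset.mem_Ioo.1 (hV h)).2 (lt_irrefl j)
  rw [pathCycle, totalBoundary_ι_mul, lieDer_pathProd R hV hij.le hi hj hij.ne hij.ne',
    totalBoundary_pathProd R hV, mul_neg, neg_neg, sub_zero, Finset.mul_sum]
  refine Finset.sum_eq_zero fun v _ => ?_
  rw [pathCycle, ← mul_assoc, ι_sq_zero, zero_mul]

/-- Splitting off a path `i → u → w → j` allows to exchange an intermediate vertex of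
`pathCycle`, up to a boundary. -/
theorem totalBoundary_path_mul_pathCycle {i j u w : Fin n} {V : Finset (Fin n)}
    (hiu : i < u) (huw : u < w) (hwj : w < j) (hV : V ⊆ Finset.Ioo i j) (hu : u ∉ V)
    (hw : w ∉ V) :
    totalBoundary R (sol R n)
      (unitForm R i u * (unitForm R u w * (unitForm R w j * pathCycle R i j V))) =
      pathCycle R i j (insert u V) - pathCycle R i j (insert w V) := by
  have hi : i ∉ V := fun h => absurd (Finset.mem_Ioo.1 (hV h)).1 (lt_irrefl i)
  have hj : j ∉ V := fun h => absurd (Finset.mem_Ioo.1 (hV h)).2 (lt_irrefl j)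
  have hiw := hiu.trans huw
  have huj := huw.trans hwj
  have hij := hiu.trans huj
  rw [totalBoundary_ι_mul, totalBoundary_ι_mul, totalBoundary_ι_mul,
    totalBoundary_pathCycle R hij hV,
    lieDer_pathCycle R hV hij.le hwj.le hw hj hwj.ne hij.ne', lieDer_ι_mul,
    lieDer_pathCycle R hV hij.le huw.le hu hw huj.ne hiw.ne', lieDer_ι_mul, lieDer_ι_mul,
    lieDer_pathCycle R hV hij.le hiu.le hi hu hij.ne hiu.ne',
    lie_solUnit R huw.le hwj.le, lie_solUnit R hiu.le huw.le, lie_solUnit R hiu.le hwj.le,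
    if_pos rfl, if_pos rfl, if_neg huj.ne', if_neg hiw.ne', if_neg huw.ne, if_neg hij.ne',
    pathCycle_insert R i j hu, pathCycle_insert R i j hw]
  simp

theorem exists_ι_mul_eq_smul_basis {L I : Type*} [AddCommGroup L] [Module R L] [LinearOrder I]
    (b : Basis I R L) {z : ExteriorAlgebra R L} {S : Finset I}
    (hz : ∃ ε : ℤˣ, z = ε • b.ExteriorAlgebra S) {x : I} (hx : x ∉ S) :
    ∃ ε : ℤˣ, ι R (b x) * z = ε • b.ExteriorAlgebra (insert x S) := by
  obtain ⟨ε, rfl⟩ := hz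
  obtain ⟨ε', h⟩ := ι_mul_basis_of_notMem b hx
  exact ⟨ε * ε', by rw [mul_smul_comm, h, smul_smul]⟩

theorem pathProd_eq_smul_basis {i j : Fin n} {V : Finset (Fin n)} (hV : V ⊆ Finset.Ioo i j) :
    ∃ ε : ℤˣ, pathProd R i j V = ε • (solBasis R n).ExteriorAlgebra (pathSet i j V) := by
  induction V using Finset.induction_on with
  | empty => exact ⟨1, by rw [pathProd_empty, pathSet_empty, basis_exteriorAlgebra_empty, one_smul]⟩
  | insert v V hv ih =>
    rw [Finset.insert_subset_iff, Finset.mem_Ioo] at hV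
    rw [pathProd_insert R i j hv, pathSet_insert V hV.1.1.le hV.1.2.le, unitForm, unitForm,
      solUnit_of_le R hV.1.1.le, solUnit_of_le R hV.1.2.le]
    exact exists_ι_mul_eq_smul_basis R _ (exists_ι_mul_eq_smul_basis R _ (ih hV.2)
      (mk_col_notMem_pathSet hv hV.1.2.le hV.2)) (mk_notMem_insert_pathSet hv hV.1.1 hV.1.2 hV.2)

theorem pathCycle_eq_smul_basis {i j : Fin n} {V : Finset (Fin n)} (hij : i ≤ j)
    (hV : V ⊆ Finset.Ioo i j) :
    ∃ ε : ℤˣ, pathCycle R i j V =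
      ε • (solBasis R n).ExteriorAlgebra (insert (mk i j hij) (pathSet i j V)) := by
  rw [pathCycle, unitForm, solUnit_of_le R hij]
  exact exists_ι_mul_eq_smul_basis R _ (pathProd_eq_smul_basis R hV) (mk_notMem_pathSet hij hV)

theorem pathCycle_mem_exteriorPower {i j : Fin n} {V : Finset (Fin n)} (hij : i ≤ j)
    (hV : V ⊆ Finset.Ioo i j) : pathCycle R i j V ∈ ⋀[R]^(2 * V.card + 1) (sol R n) := by
  obtain ⟨ε, h⟩ := pathCycle_eq_smul_basis R hij hV
  rw [h, ← card_pathSet hV, ← Finset.card_insert_of_notMem (mk_notMem_pathSet hij hV),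
    Units.smul_def]
  exact zsmul_mem (basis_mem_exteriorPower _ _) _

/-- The class of `pathCycle R i j V` only depends on the cardinality of `V`: exchange the elements
of `V \ V'` one by one. -/
theorem pathCycle_sub_mem {p : ℕ} {i j : Fin n} (hij : i < j) {V V' : Finset (Fin n)}
    (hV : V ∈ (Finset.Ioo i j).powersetCard (p - 1))
    (hV' : V' ∈ (Finset.Ioo i j).powersetCard (p - 1)) :
    pathCycle R i j V - pathCycle R i j V' ∈
      (⋀[R]^(2 * p) (sol R n)).map (totalBoundary R (sol R n)) := by
  induction hm : (V \ V').card using Nat.strong_induction_on generalizing V with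
  | _ m ih =>
  by_cases hne : V = V'
  · rw [hne, sub_self]; exact zero_mem _
  rw [Finset.mem_powersetCard] at hV hV'
  have hnsub : ¬ V ⊆ V' := fun h => hne (Finset.eq_of_subset_of_card_le h (by omega))
  have hnsub' : ¬ V' ⊆ V := fun h => hne (Finset.eq_of_subset_of_card_le h (by omega)).symm
  obtain ⟨u, hu, hu'⟩ := Finset.not_subset.1 hnsub
  obtain ⟨w, hw, hw'⟩ := Finset.not_subset.1 hnsub'
  have hiu := Finset.mem_Ioo.1 (hV.1 hu)
  have hiw := Finset.mem_Ioo.1 (hV'.1 hw)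
  have hpos := Finset.card_pos.2 ⟨u, hu⟩
  set V₀ := V.erase u with hV₀
  have huV₀ : u ∉ V₀ := Finset.notMem_erase _ _
  have hwV₀ : w ∉ V₀ := fun h => hw' (Finset.mem_of_mem_erase h)
  have hV₀sub : V₀ ⊆ Finset.Ioo i j := (Finset.erase_subset _ _).trans hV.1
  have hins : insert u V₀ = V := Finset.insert_erase hu
  have hcard : V₀.card + 1 = V.card := Finset.card_erase_add_one hu
  have hmem : ∀ {a b c : sol R n}, ι R a * (ι R b * (ι R c * pathCycle R i j V₀)) ∈
      ⋀[R]^(2 * p) (sol R n) := by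
    intro a b c
    have := ι_mul_mem_exteriorPower a (ι_mul_mem_exteriorPower b (ι_mul_mem_exteriorPower c
      (pathCycle_mem_exteriorPower R hij.le hV₀sub)))
    convert this using 2
    omega
  have h1 : pathCycle R i j V - pathCycle R i j (insert w V₀) ∈
      (⋀[R]^(2 * p) (sol R n)).map (totalBoundary R (sol R n)) := by
    rcases lt_trichotomy u w with h | h | h
    · refine ⟨_, hmem, (totalBoundary_path_mul_pathCycle R hiu.1 h hiw.2 hV₀sub huV₀ hwV₀).trans ?_⟩
      rw [hins]
    · exact absurd (h ▸ hw) hu'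
    · rw [← neg_mem_iff, neg_sub]
      refine ⟨_, hmem, (totalBoundary_path_mul_pathCycle R hiw.1 h hiu.2 hV₀sub hwV₀ huV₀).trans ?_⟩
      rw [hins]
  have hlt : (insert w V₀ \ V').card < m := by
    rw [← hm]
    refine Finset.card_lt_card (Finset.ssubset_iff_of_subset (fun x hx => ?_) |>.2
      ⟨u, by simp [hu, hu'], by simp [hV₀, show u ≠ w from fun h => hu' (h ▸ hw)]⟩)
    simp only [Finset.mem_sdiff, Finset.mem_insert, hV₀, Finset.mem_erase] at hx ⊢
    rcases hx with ⟨rfl | h, h'⟩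
    · exact absurd hw h'
    · exact ⟨h.2, h'⟩
  have h2 := ih _ hlt (V := insert w V₀) (Finset.mem_powersetCard.2
    ⟨Finset.insert_subset (hV'.1 hw) hV₀sub, by
      rw [Finset.card_insert_of_notMem hwV₀]; omega⟩) rfl
  simpa using add_mem h1 h2

/-- The linear form which takes the value `1` on `pathCycle R i j V` for every `V` of cardinality
`p - 1`, and which vanishes on the other basis elements of the exterior algebra. As `pathCycle` is
a basis element only up to a sign, the coordinates are multiplied by this sign. -/
def pathForm (p : ℕ) (i j : Fin n) : ExteriorAlgebra R (sol R n) →ₗ[R] R :=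
  if hij : i ≤ j then
    ∑ V ∈ (Finset.Ioo i j).powersetCard (p - 1),
      ((solBasis R n).ExteriorAlgebra.repr (pathCycle R i j V)
        (insert (mk i j hij) (pathSet i j V))) •
      (solBasis R n).ExteriorAlgebra.coord (insert (mk i j hij) (pathSet i j V))
  else 0

theorem pathForm_apply {p : ℕ} {i j : Fin n} (hij : i ≤ j) (z : ExteriorAlgebra R (sol R n)) :
    pathForm R p i j z = ∑ V ∈ (Finset.Ioo i j).powersetCard (p - 1),
      ((solBasis R n).ExteriorAlgebra.repr (pathCycle R i j V)
        (insert (mk i j hij) (pathSet i j V))) *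
      (solBasis R n).ExteriorAlgebra.repr z (insert (mk i j hij) (pathSet i j V)) := by
  simp [pathForm, hij]

theorem pathForm_eq_zero {p : ℕ} {i j : Fin n} {z : ExteriorAlgebra R (sol R n)}
    (h : ∀ hij : i ≤ j, ∀ V ∈ (Finset.Ioo i j).powersetCard (p - 1),
      (solBasis R n).ExteriorAlgebra.repr z (insert (mk i j hij) (pathSet i j V)) = 0) :
    pathForm R p i j z = 0 := by
  by_cases hij : i ≤ j
  · rw [pathForm_apply R hij]
    exact Finset.sum_eq_zero fun V hV => by rw [h hij V hV, mul_zero]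
  · simp [pathForm, hij]

theorem repr_pathCycle_mul_self {i j : Fin n} {V : Finset (Fin n)} (hij : i ≤ j)
    (hV : V ⊆ Finset.Ioo i j) :
    (solBasis R n).ExteriorAlgebra.repr (pathCycle R i j V)
        (insert (mk i j hij) (pathSet i j V)) *
      (solBasis R n).ExteriorAlgebra.repr (pathCycle R i j V)
        (insert (mk i j hij) (pathSet i j V)) = 1 := by
  obtain ⟨ε, h⟩ := pathCycle_eq_smul_basis R hij hV
  rw [h, Units.smul_def, map_zsmul]
  rcases Int.units_eq_one_or ε with rfl | rfl <;> simp

theorem repr_pathCycle_of_ne {i j : Fin n} {V : Finset (Fin n)} (hij : i ≤ j)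
    (hV : V ⊆ Finset.Ioo i j) {S : Finset (UpperIndex n)}
    (hS : insert (mk i j hij) (pathSet i j V) ≠ S) :
    (solBasis R n).ExteriorAlgebra.repr (pathCycle R i j V) S = 0 := by
  obtain ⟨ε, h⟩ := pathCycle_eq_smul_basis R hij hV
  rw [h, Units.smul_def, map_zsmul]
  simp [hS]

theorem insert_pathSet_injOn {i j : Fin n} (hij : i ≤ j) {V V' : Finset (Fin n)}
    (hV : V ⊆ Finset.Ioo i j) (hV' : V' ⊆ Finset.Ioo i j)
    (h : insert (mk i j hij) (pathSet i j V) = insert (mk i j hij) (pathSet i j V')) :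
    V = V' := by
  have key : ∀ {W W' : Finset (Fin n)}, W ⊆ Finset.Ioo i j → W' ⊆ Finset.Ioo i j →
      insert (mk i j hij) (pathSet i j W) = insert (mk i j hij) (pathSet i j W') → W ⊆ W' := by
    intro W W' hW hW' h v hv
    have hv' := Finset.mem_Ioo.1 (hW hv)
    have : mk i v hv'.1.le ∈ insert (mk i j hij) (pathSet i j W') := by
      rw [← h]
      exact Finset.mem_insert_of_mem (mem_pathSet.2 (Or.inl ⟨rfl, hv⟩))
    rw [Finset.mem_insert, mem_pathSet] at this
    rcases this with h1 | ⟨-, h1⟩ | ⟨h1, -⟩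
    · exact absurd (congrArg col h1) hv'.2.ne
    · exact h1
    · exact absurd (Finset.mem_Ioo.1 (hW' h1)).1 (lt_irrefl i)
  exact (key hV hV' h).antisymm (key hV' hV h.symm)

theorem pathForm_pathCycle_self {p : ℕ} {i j : Fin n} (hij : i ≤ j) {V : Finset (Fin n)}
    (hV : V ∈ (Finset.Ioo i j).powersetCard (p - 1)) :
    pathForm R p i j (pathCycle R i j V) = 1 := by
  have hV1 := (Finset.mem_powersetCard.1 hV).1
  rw [pathForm_apply R hij, Finset.sum_eq_single_of_mem V hV, repr_pathCycle_mul_self R hij hV1]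
  intro V' hV' hne
  rw [repr_pathCycle_of_ne R hij hV1, mul_zero]
  exact fun h => hne (insert_pathSet_injOn hij hV1 (Finset.mem_powersetCard.1 hV').1 h).symm

theorem sum_weight_insert_pathSet {p : ℕ} (hp0 : 0 < p) {i j : Fin n} (hij : i ≤ j)
    {V : Finset (Fin n)} (hV : V ∈ (Finset.Ioo i j).powersetCard (p - 1)) :
    ∑ x ∈ insert (mk i j hij) (pathSet i j V), x.weight =
      p • (Pi.single i 1 - Pi.single j 1) := by
  rw [Finset.mem_powersetCard] at hV
  rw [Finset.sum_insert (mk_notMem_pathSet hij hV.1), sum_weight_pathSet hV.1, hV.2]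
  simp only [weight, row_mk, col_mk]
  rw [← succ_nsmul', Nat.sub_add_cancel hp0]

theorem smul_single_sub_single_inj {p : ℕ} (hp0 : 0 < p) {i j i' j' : Fin n} (hij : i < j)
    (h : p • (Pi.single i 1 - Pi.single j 1 : Fin n → ℤ) =
      p • (Pi.single i' 1 - Pi.single j' 1)) : i = i' ∧ j = j' := by
  have h' : (Pi.single i 1 - Pi.single j 1 : Fin n → ℤ) = Pi.single i' 1 - Pi.single j' 1 :=
    nsmul_right_injective hp0.ne' h
  constructor
  · have := congrFun h' i
    by_contra hne
    simp only [Pi.sub_apply, Pi.single_apply, if_neg hij.ne, if_neg hne, if_true] at this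
    split_ifs at this <;> omega
  · have := congrFun h' j
    by_contra hne
    simp only [Pi.sub_apply, Pi.single_apply, if_neg hij.ne', if_neg hne, if_true] at this
    split_ifs at this <;> omega

theorem pathForm_pathCycle_of_ne {p : ℕ} (hp0 : 0 < p) {i j i' j' : Fin n} (hij : i < j)
    {V : Finset (Fin n)} (hV : V ∈ (Finset.Ioo i j).powersetCard (p - 1))
    (hne : ¬ (i = i' ∧ j = j')) : pathForm R p i' j' (pathCycle R i j V) = 0 := by
  refine pathForm_eq_zero R fun hij' V' hV' => ?_
  refine repr_pathCycle_of_ne R hij.le (Finset.mem_powersetCard.1 hV).1 fun h => hne ?_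
  refine smul_single_sub_single_inj hp0 hij ?_
  rw [← sum_weight_insert_pathSet hp0 hij.le hV, h, sum_weight_insert_pathSet hp0 hij' hV']

theorem row_lt_col_of_mem_insert_pathSet {i j : Fin n} (hij : i < j) {V : Finset (Fin n)}
    (hV : V ⊆ Finset.Ioo i j) {x : UpperIndex n}
    (hx : x ∈ insert (mk i j hij.le) (pathSet i j V)) : x.row < x.col := by
  rw [Finset.mem_insert, mem_pathSet] at hx
  rcases hx with rfl | ⟨h1, h2⟩ | ⟨h1, h2⟩
  · exact hij
  · exact h1 ▸ (Finset.mem_Ioo.1 (hV h2)).1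
  · exact h2 ▸ (Finset.mem_Ioo.1 (hV h1)).2

/-- Only sets of weight `p (ε_i - ε_j)` matter. A diagonal position in such a set contributes its
weight, which is a multiple of `p`; the sets without diagonal positions are those of
`eq_pathSet_or_of_sum_weight`. -/
theorem pathForm_totalBoundary_basis {p : ℕ} (hp2 : 2 ≤ p) {i j : Fin n} (hij : i < j)
    {S : Finset (UpperIndex n)} (hS : S.card = 2 * p) :
    (p : R) ∣ pathForm R p i j
      (totalBoundary R (sol R n) ((solBasis R n).ExteriorAlgebra S)) := by
  by_cases hw : ∑ x ∈ S, x.weight = p • (Pi.single i 1 - Pi.single j 1)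
  swap
  · rw [pathForm_eq_zero]
    · exact dvd_zero _
    · intro hij' V hV
      refine repr_eq_zero_of_mem_weightSpace _ weight (totalBoundary_basis_mem_weightSpace _
        (lie_solBasis_mem_span R) S) ?_
      rw [sum_weight_insert_pathSet (by omega) hij' hV]
      exact Ne.symm hw
  by_cases hdiag : ∃ x ∈ S, x.row = x.col
  · obtain ⟨x, hx, hxd⟩ := hdiag
    obtain ⟨ε, hε⟩ := basis_insert (solBasis R n) (Finset.notMem_erase x S)
    have hxw : x.weight = 0 := by simp [weight, hxd]
    have hw' : ∑ y ∈ S.erase x, y.weight = p • (Pi.single i 1 - Pi.single j 1) := by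
      rw [← hw, ← Finset.add_sum_erase S weight hx, hxw, zero_add]
    rw [Finset.insert_erase hx] at hε
    have hzero : ∀ z, pathForm R p i j (ι R (solBasis R n x) * z) = 0 := fun z =>
      pathForm_eq_zero R fun _ V hV => repr_ι_mul_of_notMem _ (fun h =>
        (row_lt_col_of_mem_insert_pathSet hij (Finset.mem_powersetCard.1 hV).1 h).ne hxd) z
    rw [hε, Units.smul_def, map_zsmul, map_zsmul, totalBoundary_ι_mul, map_sub, map_neg, hzero,
      solBasis_eq_solUnit, ← hxd, lieDer_basis_of_lie_eq_smul _ (lie_solUnit_diag R x.row),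
      map_smul, neg_zero, zero_sub, ← Finset.sum_apply, hw']
    rw [zsmul_eq_mul]
    refine (dvd_neg.2 (Dvd.dvd.mul_right ?_ _)).mul_left _
    refine ⟨((Pi.single i 1 - Pi.single j 1 : Fin n → ℤ) x.row : ℤ), ?_⟩
    rw [Pi.smul_apply]
    simp
  · have hlt : ∀ x ∈ S, x.row < x.col := fun x hx =>
      lt_of_le_of_ne x.row_le_col fun h => hdiag ⟨x, hx, h⟩
    rcases eq_pathSet_or_of_sum_weight hp2 hS hlt hij hw with ⟨V, hV, rfl⟩ |
      ⟨u, w, hiu, huw, hwj, V, hV, hu, hwV, rfl⟩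
    · rw [Finset.mem_powersetCard] at hV
      obtain ⟨ε, hε⟩ := pathProd_eq_smul_basis R hV.1
      rw [← inv_smul_eq_iff] at hε
      rw [← hε, Units.smul_def, map_zsmul, map_zsmul, totalBoundary_pathProd R hV.1, map_neg,
        map_sum, Finset.sum_congr rfl fun v hv => pathForm_pathCycle_self R hij.le
          (Finset.mem_powersetCard.2 ⟨(Finset.erase_subset v V).trans hV.1, by
            rw [Finset.card_erase_of_mem hv, hV.2]⟩)]
      simp [hV.2]
    · rw [Finset.mem_powersetCard] at hV
      have hiw := hiu.trans huw
      have huj := huw.trans hwj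
      obtain ⟨ε, hε⟩ : ∃ ε : ℤˣ, unitForm R i u * (unitForm R u w *
          (unitForm R w j * pathCycle R i j V)) = ε • (solBasis R n).ExteriorAlgebra
            (insert (mk i u hiu.le) (insert (mk u w huw.le) (insert (mk w j hwj.le)
          (insert (mk i j hij.le) (pathSet i j V))))) := by
        rw [unitForm, unitForm, unitForm, solUnit_of_le R hiu.le, solUnit_of_le R huw.le,
          solUnit_of_le R hwj.le]
        refine exists_ι_mul_eq_smul_basis R _ (exists_ι_mul_eq_smul_basis R _
          (exists_ι_mul_eq_smul_basis R _ (pathCycle_eq_smul_basis R hij.le hV.1) ?_) ?_) ?_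
        · rw [Finset.mem_insert, not_or]
          exact ⟨fun h => hiw.ne' (congrArg row h), mk_col_notMem_pathSet hwV hwj.le hV.1⟩
        · rw [Finset.mem_insert, Finset.mem_insert, not_or, not_or, mem_pathSet]
          exact ⟨fun h => huw.ne (congrArg row h), fun h => hiu.ne' (congrArg row h),
            not_or.2 ⟨fun h => hiu.ne' h.1, fun h => hwj.ne h.2⟩⟩
        · rw [Finset.mem_insert, Finset.mem_insert, Finset.mem_insert, not_or, not_or, not_or]
          exact ⟨fun h => hiu.ne (congrArg row h), fun h => hiw.ne (congrArg row h),
            fun h => huj.ne (congrArg col h), mk_row_notMem_pathSet hu hiu.le hV.1⟩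
      rw [← inv_smul_eq_iff] at hε
      have hmem : ∀ v, i < v → v < j → v ∉ V →
          insert v V ∈ (Finset.Ioo i j).powersetCard (p - 1) := fun v h1 h2 h3 =>
        Finset.mem_powersetCard.2 ⟨Finset.insert_subset (Finset.mem_Ioo.2 ⟨h1, h2⟩) hV.1, by
          rw [Finset.card_insert_of_notMem h3, hV.2]; omega⟩
      rw [← hε, Units.smul_def, map_zsmul, map_zsmul,
        totalBoundary_path_mul_pathCycle R hiu huw hwj hV.1 hu hwV, map_sub,
        pathForm_pathCycle_self R hij.le (hmem u hiu huj hu),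
        pathForm_pathCycle_self R hij.le (hmem w hiw hwj hwV)]
      simp

/-- The form `pathForm` is a cocycle modulo `p`. -/
theorem dvd_pathForm_totalBoundary {p : ℕ} (hp2 : 2 ≤ p) {i j : Fin n} (hij : i < j)
    {z : ExteriorAlgebra R (sol R n)} (hz : z ∈ ⋀[R]^(2 * p) (sol R n)) :
    (p : R) ∣ pathForm R p i j (totalBoundary R (sol R n) z) := by
  rw [mem_exteriorPower_iff (solBasis R n)] at hz
  rw [← (solBasis R n).ExteriorAlgebra.sum_repr z, map_sum, map_sum]
  refine Finset.dvd_sum fun S _ => ?_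
  rw [map_smul, map_smul]
  by_cases hS : (solBasis R n).ExteriorAlgebra.repr z S = 0
  · simp [hS]
  · exact (pathForm_totalBoundary_basis R hp2 hij (hz S hS)).mul_left _

end PathProducts

end ChevalleyEilenberg

/-! ### Contraction onto the weights divisible by `p` -/

namespace ChevalleyEilenberg

section SolHomology

open ExteriorAlgebra Module UpperIndex

/-- Integral coefficients `c α`, depending on the weight `α`, such that `∑ a, α a * c α a` is
congruent to `1` modulo `p` unless `p` divides `α`. -/
theorem exists_coeff {p : ℕ} (hp : p.Prime) {A : Type*} [Fintype A] :
    ∃ (c : (A → ℤ) → A → ℤ) (e : (A → ℤ) → ℤ), ∀ α : A → ℤ,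
      ∑ a, α a * c α a = if ∀ a, (p : ℤ) ∣ α a then 0 else 1 + p * e α := by
  classical
  have h : ∀ α : A → ℤ, ∃ (c : A → ℤ) (e : ℤ),
      ∑ a, α a * c a = if ∀ a, (p : ℤ) ∣ α a then 0 else 1 + p * e := by
    intro α
    split_ifs with hα
    · exact ⟨0, 0, by simp⟩
    · push Not at hα
      obtain ⟨a, ha⟩ := hα
      obtain ⟨u, v, huv⟩ := ((Nat.prime_iff_prime_int.1 hp).coprime_iff_not_dvd).2 ha
      refine ⟨Pi.single a v, -u, ?_⟩
      rw [Finset.sum_eq_single a (fun b _ hb => by simp [hb]) (by simp), Pi.single_eq_same]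
      linarith
  choose c e hce using h
  exact ⟨c, e, hce⟩

/-- The weights of `S` are divisible by `p`. -/
def WeightDvd {n : ℕ} (p : ℕ) (S : Finset (UpperIndex n)) : Prop :=
  ∀ a, (p : ℤ) ∣ (∑ x ∈ S, x.weight) a

/-- All elements of `S` lie on the diagonal. -/
def IsDiag {n : ℕ} (S : Finset (UpperIndex n)) : Prop := ∀ x ∈ S, x.row = x.col

theorem IsDiag.sum_weight {n : ℕ} {S : Finset (UpperIndex n)} (h : IsDiag S) :
    ∑ x ∈ S, x.weight = 0 :=
  Finset.sum_eq_zero fun x hx => by simp [weight, h x hx]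

theorem IsDiag.weightDvd {n : ℕ} (p : ℕ) {S : Finset (UpperIndex n)} (h : IsDiag S) :
    WeightDvd p S := fun a => by rw [h.sum_weight]; exact dvd_zero _

theorem nonempty_of_not_isDiag {n : ℕ} {S : Finset (UpperIndex n)} (h : ¬ IsDiag S) :
    (S.filter fun x => x.row < x.col).Nonempty := by
  simp only [IsDiag, not_forall] at h
  obtain ⟨x, hx, hne⟩ := h
  exact ⟨x, Finset.mem_filter.2 ⟨hx, lt_of_le_of_ne x.row_le_col hne⟩⟩

theorem WeightDvd.filter {n p : ℕ} {S : Finset (UpperIndex n)} (h : WeightDvd p S) :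
    WeightDvd p (S.filter fun x => x.row < x.col) := by
  rwa [WeightDvd, sum_weight_filter_row_lt_col]

/-- The roots are positive, hence a sum of roots is zero only if it is empty. -/
theorem isDiag_of_sum_weight {n : ℕ} {S : Finset (UpperIndex n)}
    (h : ∑ x ∈ S, x.weight = 0) : IsDiag S := by
  by_contra hS
  obtain ⟨i, j, -, -, -, -, hpos, -⟩ := exists_extremal (p := 0) (nonempty_of_not_isDiag hS)
    (fun x hx => (Finset.mem_filter.1 hx).2) fun a => by
      rw [sum_weight_filter_row_lt_col, h]; simp
  rw [sum_weight_filter_row_lt_col, h] at hpos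
  exact lt_irrefl _ hpos

variable (R : Type*) [CommRing R] {n : ℕ}

open Classical in
/-- The torus contracts the exterior algebra, up to multiples of `p`, onto the weights divisible
by `p`. The error term is diagonal, with entries which depend on the weight only; so it commutes
with the boundary. -/
theorem exists_homotopy {p : ℕ} (hp : p.Prime) (n : ℕ) :
    ∃ (s : ExteriorAlgebra R (sol R n) →ₗ[R] ExteriorAlgebra R (sol R n)) (e : (Fin n → ℤ) → R),
      (∀ k, ∀ z ∈ ⋀[R]^k (sol R n), s z ∈ ⋀[R]^(k + 1) (sol R n)) ∧
      ∀ z, totalBoundary R (sol R n) (s z) + s (totalBoundary R (sol R n) z) =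
        z - diagonal (solBasis R n) (fun S => if WeightDvd p S then 1 else 0) z +
          (p : R) • diagonal (solBasis R n) (fun S => e (∑ x ∈ S, x.weight)) z := by
  obtain ⟨c, e, hce⟩ := exists_coeff hp (A := Fin n)
  refine ⟨torusHomotopy (solBasis R n) (fun a => solUnit R a a) weight (fun α a => (c α a : R)),
    fun α => if ∀ a, (p : ℤ) ∣ α a then 0 else (e α : R),
    fun k z hz => torusHomotopy_mem_exteriorPower _ _ hz, fun z => ?_⟩
  rw [totalBoundary_torusHomotopy _ (lie_solBasis_mem_span R) (lie_solUnit_diag R)]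
  refine (solBasis R n).ExteriorAlgebra.repr.injective (Finsupp.ext fun S => ?_)
  simp only [map_add, map_sub, map_smul, Finsupp.add_apply, Finsupp.sub_apply, Finsupp.smul_apply,
    repr_diagonal, smul_eq_mul]
  have h := congrArg (Int.cast (R := R)) (hce (∑ x ∈ S, x.weight))
  push_cast at h
  rw [h, WeightDvd]
  split_ifs <;> ring

variable {R}

/-- If the weight of `S` vanishes in `R`, then the diagonal positions split off from the
boundary. -/
theorem totalBoundary_basis_eq_zero {S : Finset (UpperIndex n)}
    (h0 : totalBoundary R (sol R n)
      ((solBasis R n).ExteriorAlgebra (S.filter fun x => x.row < x.col)) = 0)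
    (hw : ∀ a, (((∑ x ∈ S, x.weight) a : ℤ) : R) = 0) :
    totalBoundary R (sol R n) ((solBasis R n).ExteriorAlgebra S) = 0 := by
  induction S using Finset.strongInduction with
  | _ S ih =>
  by_cases hdiag : ∃ x ∈ S, x.row = x.col
  · obtain ⟨x, hx, hxd⟩ := hdiag
    obtain ⟨ε, hε⟩ := basis_insert (solBasis R n) (Finset.notMem_erase x S)
    have hxw : x.weight = 0 := by simp [weight, hxd]
    have hw' : ∑ y ∈ S.erase x, y.weight = ∑ y ∈ S, y.weight := by
      rw [← Finset.add_sum_erase S weight hx, hxw, zero_add]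
    have hf : (S.erase x).filter (fun x => x.row < x.col) = S.filter fun x => x.row < x.col := by
      rw [Finset.filter_erase, Finset.erase_eq_of_notMem]
      simp [hxd]
    rw [Finset.insert_erase hx] at hε
    rw [hε, Units.smul_def, map_zsmul, totalBoundary_ι_mul,
      ih _ (Finset.erase_ssubset hx) (by rwa [hf]) (by rwa [hw']),
      solBasis_eq_solUnit, ← hxd, lieDer_basis_of_lie_eq_smul _ (lie_solUnit_diag R x.row),
      ← Finset.sum_apply, hw', hw]
    simp
  · rwa [Finset.filter_true_of_mem] at h0
    exact fun x hx => lt_of_le_of_ne x.row_le_col fun h => hdiag ⟨x, hx, h⟩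

theorem totalBoundary_basis_of_isDiag {S : Finset (UpperIndex n)} (hS : IsDiag S) :
    totalBoundary R (sol R n) ((solBasis R n).ExteriorAlgebra S) = 0 := by
  refine totalBoundary_basis_eq_zero ?_ fun a => by rw [hS.sum_weight]; exact Int.cast_zero
  rw [Finset.filter_false_of_mem fun x hx => (hS x hx).not_lt, basis_exteriorAlgebra_empty,
    totalBoundary_one]

/-- A coordinate of a boundary vanishes if the boundaries of all basis elements of the same weight
vanish. -/
theorem repr_totalBoundary_eq_zero {S : Finset (UpperIndex n)}
    (h : ∀ T : Finset (UpperIndex n), ∑ x ∈ T, x.weight = ∑ x ∈ S, x.weight →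
      totalBoundary R (sol R n) ((solBasis R n).ExteriorAlgebra T) = 0)
    (z : ExteriorAlgebra R (sol R n)) :
    (solBasis R n).ExteriorAlgebra.repr (totalBoundary R (sol R n) z) S = 0 := by
  suffices H : (solBasis R n).ExteriorAlgebra.coord S ∘ₗ totalBoundary R (sol R n) = 0 from
    LinearMap.congr_fun H z
  refine (solBasis R n).ExteriorAlgebra.ext fun T => ?_
  by_cases hT : ∑ x ∈ T, x.weight = ∑ x ∈ S, x.weight
  · simp [h T hT]
  · exact repr_eq_zero_of_mem_weightSpace _ weight (totalBoundary_basis_mem_weightSpace _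
        (lie_solBasis_mem_span R) T) (Ne.symm hT)

theorem repr_totalBoundary_of_isDiag {S : Finset (UpperIndex n)} (hS : IsDiag S)
    (z : ExteriorAlgebra R (sol R n)) :
    (solBasis R n).ExteriorAlgebra.repr (totalBoundary R (sol R n) z) S = 0 :=
  repr_totalBoundary_eq_zero (fun _ hT => totalBoundary_basis_of_isDiag
    (isDiag_of_sum_weight (hT.trans hS.sum_weight))) z

theorem isDiag_of_le {p : ℕ} (h : n ≤ p) {S : Finset (UpperIndex n)} (hS : WeightDvd p S) :
    IsDiag S := by
  by_contra hd
  exact absurd (lt_of_weight_dvd (nonempty_of_not_isDiag hd)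
    (fun x hx => (Finset.mem_filter.1 hx).2) hS.filter) (by omega)

theorem isDiag_of_card_lt {p : ℕ} (hp0 : 0 < p) {S : Finset (UpperIndex n)}
    (h : S.card < 2 * p - 1) (hS : WeightDvd p S) : IsDiag S := by
  by_contra hd
  have h1 := le_card_of_weight_dvd hp0 (nonempty_of_not_isDiag hd)
    (fun x hx => (Finset.mem_filter.1 hx).2) hS.filter
  have h2 := Finset.card_filter_le S fun x => x.row < x.col
  omega

/-! ### Torsion in the integral homology -/

theorem _root_.HasPrimePowerSummand.hasTorsion {p : ℕ} [hp : Fact p.Prime] {M : Type*}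
    [AddCommGroup M] (h : HasPrimePowerSummand p M) : HasTorsion p M := by
  obtain ⟨l, hl, N, ⟨e⟩⟩ := h
  obtain ⟨l, rfl⟩ : ∃ m, l = m + 1 := ⟨l - 1, by omega⟩
  refine ⟨e.symm (((p ^ l : ℕ) : ZMod (p ^ (l + 1))), 0), ?_, ?_⟩
  · rw [Ne, EmbeddingLike.map_eq_zero_iff, Prod.mk_eq_zero, not_and_or]
    left
    rw [ZMod.natCast_eq_zero_iff, Nat.pow_dvd_pow_iff_le_right hp.out.one_lt]
    omega
  · rw [← map_nsmul, EmbeddingLike.map_eq_zero_iff, Prod.mk_eq_zero]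
    refine ⟨?_, smul_zero _⟩
    change p • ((p ^ l : ℕ) : ZMod (p ^ (l + 1))) = 0
    rw [nsmul_eq_mul, ← Nat.cast_mul, ← pow_succ', ZMod.natCast_self]

/-- An element of order `m` on which a homomorphism to `ℤ/m` is `1` splits off. -/
theorem exists_zmod_summand {m : ℕ} {M : Type*} [AddCommGroup M] (f : M →+ ZMod m) (x : M)
    (hx : m • x = 0) (hf : f x = 1) :
    ∃ N : AddSubgroup M, Nonempty (M ≃+ ZMod m × N) := by
  let σ : ZMod m →+ M := ZMod.lift m ⟨zmultiplesHom M x, by simpa using hx⟩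
  have hσ : ∀ y, f (σ y) = y := by
    intro y
    obtain ⟨y, rfl⟩ := ZMod.intCast_surjective y
    simp [σ, hf]
  refine ⟨f.ker, ⟨?_⟩⟩
  exact
    { toFun := fun y => (f y, ⟨y - σ (f y), by simp [AddMonoidHom.mem_ker, hσ]⟩)
      invFun := fun y => σ y.1 + y.2
      left_inv := fun y => by simp
      right_inv := fun y => by
        have h2 : f y.2 = 0 := y.2.2
        ext <;> simp [hσ, h2]
      map_add' := fun y z => by
        ext
        · simp
        · simp; abel }

variable (R)

/-- There is no `p`-torsion in a degree in which only diagonal sets have weight divisible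
by `p`. -/
theorem not_hasTorsion {p : ℕ} (hp : p.Prime) (hR : ∀ r : R, (p : R) * r = 0 → r = 0) {k : ℕ}
    (h : ∀ S : Finset (UpperIndex n), S.card = k → WeightDvd p S → IsDiag S) :
    ¬ HasTorsion p (solHomology R n k) := by
  classical
  refine Homology.not_hasTorsion fun z hz hdz y hy hdy => ?_
  obtain ⟨s, e, hs, hse⟩ := exists_homotopy R hp n
  -- the diagonal coordinates of `p z` vanish, since `p z` is a boundary, and `p` is regular
  have hP : diagonal (solBasis R n) (fun S => if WeightDvd p S then 1 else 0)
      z = 0 := by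
    refine (solBasis R n).ExteriorAlgebra.repr.injective (Finsupp.ext fun S => ?_)
    rw [repr_diagonal, map_zero, Finsupp.zero_apply]
    split_ifs with hS
    · by_contra hne
      rw [one_mul] at hne
      have hc := (mem_exteriorPower_iff (solBasis R n)).1 hz S hne
      have h0 := repr_totalBoundary_of_isDiag (h S hc hS) y
      rw [hdy, map_smul, Finsupp.smul_apply, smul_eq_mul] at h0
      exact hne (hR _ h0)
    · exact zero_mul _
  -- the homotopy yields `∂(s z) = z + p e z`, and `p e z = e (∂ y) = ∂ (e y)`
  have key := hse z
  rw [hdz, map_zero, add_zero, hP, sub_zero, ← map_smul, ← hdy,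
    ← totalBoundary_diagonal (solBasis R n) (lie_solBasis_mem_span R) e, ← sub_eq_iff_eq_add,
    ← map_sub] at key
  exact ⟨_, sub_mem (hs k z hz) (diagonal_mem_exteriorPower _ _ hy), key⟩

/-- The class of `pathCycle` in `H_{2p-1}(sol_{p+1})` generates a direct summand `R / p`. -/
theorem exists_class_of_order {p : ℕ} (hp : p.Prime) :
    ∃ (f : solHomology R (p + 1) (2 * p - 1) →ₗ[R] R ⧸ Ideal.span {(p : R)})
      (x : solHomology R (p + 1) (2 * p - 1)), p • x = 0 ∧ f x = 1 := by
  have hp2 := hp.two_le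
  have hlast : (0 : Fin (p + 1)) < Fin.last p := by simpa [Fin.lt_def] using hp.pos
  set V := Finset.Ioo (0 : Fin (p + 1)) (Fin.last p) with hV
  have hVcard : V.card = p - 1 := by rw [hV, Fin.card_Ioo]; simp
  have hVmem : V ∈ (Finset.Ioo (0 : Fin (p + 1)) (Fin.last p)).powersetCard (p - 1) :=
    Finset.mem_powersetCard.2 ⟨subset_rfl, hVcard⟩
  have hmem : pathCycle R 0 (Fin.last p) V ∈ ⋀[R]^(2 * p - 1) (sol R (p + 1)) := by
    have := pathCycle_mem_exteriorPower R hlast.le (V := V) subset_rfl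
    rwa [hVcard, show 2 * (p - 1) + 1 = 2 * p - 1 by omega] at this
  refine Homology.exists_class_of_order (pathForm R p 0 (Fin.last p)) (fun y hy => ?_) hmem
    (totalBoundary_pathCycle R hlast subset_rfl) (pathForm_pathCycle_self R hlast.le hVmem)
    -- `p` times the cycle is the boundary of its product with `-e_00`
    (neg_mem (ι_mul_mem_exteriorPower (solUnit R 0 0) hmem)) ?_
  · rw [show 2 * p - 1 + 1 = 2 * p by omega] at hy
    exact dvd_pathForm_totalBoundary R hp2 hlast hy
  · obtain ⟨ε, hε⟩ := pathCycle_eq_smul_basis R hlast.le (V := V) subset_rfl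
    have hder : lieDer R (solUnit R 0 0) (pathCycle R 0 (Fin.last p) V) =
        (p : R) • pathCycle R 0 (Fin.last p) V := by
      rw [hε, Units.smul_def, map_zsmul, lieDer_basis_of_lie_eq_smul _ (lie_solUnit_diag R 0),
        ← Finset.sum_apply, sum_weight_insert_pathSet hp.pos hlast.le hVmem, smul_comm]
      simp [hlast.ne']
    rw [map_neg, totalBoundary_ι_mul, totalBoundary_pathCycle R hlast subset_rfl, hder, mul_zero,
      neg_zero, zero_sub, neg_neg]

theorem hasPrimePowerSummand {p : ℕ} (hp : p.Prime) :
    HasPrimePowerSummand p (solHomology ℤ (p + 1) (2 * p - 1)) := by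
  obtain ⟨f, x, hx, hfx⟩ := exists_class_of_order ℤ hp
  refine ⟨1, le_rfl, ?_⟩
  rw [pow_one]
  refine exists_zmod_summand ((Int.quotientSpanNatEquivZMod p).toAddMonoidHom.comp
    f.toAddMonoidHom) x hx ?_
  change Int.quotientSpanNatEquivZMod p (f x) = 1
  rw [hfx, map_one]

end SolHomology

/-! ### Counting the sets of weight divisible by `p` -/

section CharP

open ExteriorAlgebra Module UpperIndex

theorem mk_self_injective (n : ℕ) :
    Function.Injective fun a : Fin n => UpperIndex.mk a a le_rfl := fun _ _ h => congrArg row h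

/-- The diagonal positions `(a, a)` with `a ∈ A`. -/
def diagSet {n : ℕ} (A : Finset (Fin n)) : Finset (UpperIndex n) :=
  A.map ⟨fun a => UpperIndex.mk a a le_rfl, mk_self_injective n⟩

theorem card_diagSet {n : ℕ} (A : Finset (Fin n)) : (diagSet A).card = A.card :=
  Finset.card_map _

theorem mem_diagSet {n : ℕ} {A : Finset (Fin n)} {x : UpperIndex n} :
    x ∈ diagSet A ↔ ∃ a ∈ A, UpperIndex.mk a a le_rfl = x :=
  Finset.mem_map

theorem diagSet_injective (n : ℕ) : Function.Injective (diagSet (n := n)) :=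
  Finset.map_injective _

theorem isDiag_iff_eq_diagSet {n : ℕ} {S : Finset (UpperIndex n)} :
    IsDiag S ↔ ∃ A, S = diagSet A := by
  constructor
  · intro h
    refine ⟨S.image row, Finset.ext fun x => ?_⟩
    simp only [mem_diagSet, Finset.mem_image]
    constructor
    · exact fun hx => ⟨_, ⟨x, hx, rfl⟩, UpperIndex.ext rfl (h x hx)⟩
    · rintro ⟨_, ⟨y, hy, rfl⟩, rfl⟩
      rwa [show UpperIndex.mk y.row y.row le_rfl = y from UpperIndex.ext rfl (h y hy)]
  · rintro ⟨A, rfl⟩ x hx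
    obtain ⟨a, -, rfl⟩ := mem_diagSet.1 hx
    rfl

open Classical in
theorem card_filter_isDiag (n k : ℕ) :
    (Finset.univ.filter fun S : Finset (UpperIndex n) => S.card = k ∧ IsDiag S).card =
      n.choose k := by
  have : (Finset.univ.filter fun S : Finset (UpperIndex n) => S.card = k ∧ IsDiag S) =
      ((Finset.univ : Finset (Fin n)).powersetCard k).map
        ⟨diagSet, diagSet_injective n⟩ := by
    ext S
    simp only [Finset.mem_filter, Finset.mem_univ, true_and, isDiag_iff_eq_diagSet,
      Finset.mem_map, Finset.mem_powersetCard, Finset.subset_univ, Function.Embedding.coeFn_mk]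
    constructor
    · rintro ⟨h, A, rfl⟩
      exact ⟨A, by rwa [card_diagSet] at h, rfl⟩
    · rintro ⟨A, h, rfl⟩
      exact ⟨by rwa [card_diagSet], A, rfl⟩
  rw [this, Finset.card_map, Finset.card_powersetCard, Finset.card_univ, Fintype.card_fin]

open Classical in
/-- The sets with `k` elements of weight divisible by `p`, for `n = p + 1`: those of diagonal
positions, and the unions of such a set and of the unique nonempty set of positive roots of weight
divisible by `p`, which has `2n - 3` elements. -/
theorem card_filter_weightDvd {p : ℕ} (hp0 : 0 < p) (k : ℕ) :
    (Finset.univ.filter fun S : Finset (UpperIndex (p + 1)) =>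
      S.card = k ∧ WeightDvd p S).card =
      (p + 1).choose k + shiftedChoose (p + 1) k (2 * (p + 1) - 3) := by
  set S₀ : Finset (UpperIndex (p + 1)) := insert (UpperIndex.mk 0 (Fin.last p) (Fin.zero_le _))
    (pathSet 0 (Fin.last p) (Finset.Ioo 0 (Fin.last p))) with hS₀
  have hlast : (0 : Fin (p + 1)) < Fin.last p := by simpa [Fin.lt_def] using hp0
  have hcard : S₀.card = 2 * (p + 1) - 3 := by
    rw [hS₀, Finset.card_insert_of_notMem (mk_notMem_pathSet _ subset_rfl),
      card_pathSet subset_rfl, Fin.card_Ioo, Fin.val_last, Fin.val_zero]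
    omega
  have hlt : ∀ x ∈ S₀, x.row < x.col := fun x hx =>
    row_lt_col_of_mem_insert_pathSet hlast subset_rfl hx
  have hS₀w : WeightDvd p S₀ := by
    intro a
    rw [sum_weight_insert_pathSet (p := p) hp0 _ (Finset.mem_powersetCard.2 ⟨subset_rfl, by
      rw [Fin.card_Ioo, Fin.val_last, Fin.val_zero]; omega⟩)]
    simp
  have hdisj : ∀ D : Finset (UpperIndex (p + 1)), IsDiag D → Disjoint S₀ D := fun D hD =>
    Finset.disjoint_left.2 fun x hx hx' => (hlt x hx).ne (hD x hx')
  -- the sets which are not diagonal are the unions of `S₀` and a diagonal set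
  have himage : (Finset.univ.filter fun S : Finset (UpperIndex (p + 1)) =>
      (S.card = k ∧ WeightDvd p S) ∧ ¬ IsDiag S) =
      if 2 * (p + 1) - 3 ≤ k then (Finset.univ.filter fun S : Finset (UpperIndex (p + 1)) =>
        S.card = k - (2 * (p + 1) - 3) ∧ IsDiag S).image (S₀ ∪ ·) else ∅ := by
    have hsub : ∀ S : Finset (UpperIndex (p + 1)), WeightDvd p S → ¬ IsDiag S →
        S.filter (fun x => x.row < x.col) = S₀ := fun S hS hd =>
      eq_insert_pathSet_of_weight_dvd hp0 (nonempty_of_not_isDiag hd)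
        (fun x hx => (Finset.mem_filter.1 hx).2) hS.filter
    ext S
    rw [Finset.mem_filter]
    split_ifs with hk
    · simp only [Finset.mem_univ, true_and, Finset.mem_image, Finset.mem_filter]
      constructor
      · rintro ⟨⟨hc, hw⟩, hd⟩
        have h1 := hsub S hw hd
        have h2 := Finset.filter_union_filter_not_eq (fun x => x.row < x.col) S
        have h3 : IsDiag (S.filter fun x => ¬ x.row < x.col) := fun x hx =>
          x.row_le_col.eq_of_not_lt (Finset.mem_filter.1 hx).2
        refine ⟨_, ⟨?_, h3⟩, h1 ▸ h2⟩
        rw [h1] at h2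
        have h4 := Finset.card_union_of_disjoint (hdisj _ h3)
        rw [h2] at h4
        omega
      · rintro ⟨D, ⟨hc, hd⟩, rfl⟩
        refine ⟨⟨?_, fun a => ?_⟩, fun h => ?_⟩
        · rw [Finset.card_union_of_disjoint (hdisj D hd)]
          omega
        · rw [Finset.sum_union (hdisj D hd), hd.sum_weight, add_zero]
          exact hS₀w a
        · have hmem : UpperIndex.mk 0 (Fin.last p) (Fin.zero_le _) ∈ S₀ :=
            Finset.mem_insert_self _ _
          exact (hlt _ hmem).ne (h _ (Finset.mem_union_left _ hmem))
    · simp only [Finset.mem_univ, true_and, Finset.notMem_empty, iff_false]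
      rintro ⟨⟨hc, hw⟩, hd⟩
      have h1 := Finset.card_filter_le S fun x => x.row < x.col
      rw [hsub S hw hd] at h1
      omega
  rw [← Finset.card_filter_add_card_filter_not (s := Finset.univ.filter
    fun S : Finset (UpperIndex (p + 1)) => S.card = k ∧ WeightDvd p S) IsDiag,
    Finset.filter_filter, Finset.filter_filter, himage]
  congr 1
  · rw [← card_filter_isDiag]
    congr 1
    ext S
    simp only [Finset.mem_filter, Finset.mem_univ, true_and]
    exact ⟨fun h => ⟨h.1.1, h.2⟩, fun h => ⟨⟨h.1, h.2.weightDvd p⟩, h.2⟩⟩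
  · rw [shiftedChoose]
    split_ifs with hk
    · rw [Finset.card_image_of_injOn, card_filter_isDiag]
      intro D hD D' hD' h
      simp only [Finset.coe_filter, Finset.mem_univ, true_and, Set.mem_ofPred_eq] at hD hD'
      have h' : S₀ ∪ D = S₀ ∪ D' := h
      rw [← Finset.union_sdiff_cancel_left (hdisj D hD.2), h',
        Finset.union_sdiff_cancel_left (hdisj D' hD'.2)]
    · rfl

/-- The number of pairs of indices with `j - i ≥ p`. -/
theorem card_filter_add_le (n p : ℕ) :
    (Finset.univ.filter fun x : Fin n × Fin n => (x.1 : ℕ) + p ≤ x.2).card =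
      (n + 1 - p).choose 2 := by
  have h : (Finset.univ.filter fun x : Fin n × Fin n => (x.1 : ℕ) + p ≤ x.2).card =
      ∑ j ∈ Finset.range n, (j + 1 - p) := by
    rw [Finset.card_filter, ← Finset.univ_product_univ, Finset.sum_product_right,
      ← Fin.sum_univ_eq_sum_range]
    refine Finset.sum_congr rfl fun j _ => ?_
    rw [← Finset.card_filter]
    have : (Finset.univ.filter fun i : Fin n => (i : ℕ) + p ≤ j).card =
        (Finset.range (j + 1 - p)).card := by
      refine Finset.card_bij (fun i _ => (i : ℕ)) (fun i hi => ?_) (fun i _ i' _ h => Fin.ext h)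
        fun i hi => ?_
      · simp only [Finset.mem_filter, Finset.mem_univ, true_and] at hi
        rw [Finset.mem_range]; omega
      · rw [Finset.mem_range] at hi
        exact ⟨⟨i, by omega⟩, by simp; omega, rfl⟩
    rw [this, Finset.card_range]
  rw [h]
  clear h
  induction n with
  | zero => rcases p with _ | p <;> simp [Nat.choose_eq_zero_of_lt]
  | succ n ih =>
    rw [Finset.sum_range_succ, ih]
    by_cases hp : p ≤ n + 1
    · obtain ⟨m, hm⟩ := Nat.exists_eq_add_of_le hp
      rw [hm, show p + m + 1 - p = m + 1 by omega, show p + m - p = m by omega,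
        Nat.choose_succ_succ' m 1, Nat.choose_one_right]
      ring
    · rw [show n + 1 + 1 - p = 0 by omega, show n + 1 - p = 0 by omega, add_zero]

/-! ### Homology in characteristic `p` -/

variable (R : Type*) [CommRing R]

theorem nonempty_fun_equiv_prod {J : Type*} [Fintype J] {a b : ℕ} (h : Fintype.card J = a + b) :
    Nonempty ((J → R) ≃ₗ[R] (Fin a → R) × (Fin b → R)) := by
  have e : Fin a ⊕ Fin b ≃ J := Fintype.equivOfCardEq (by simp [h])
  exact ⟨(LinearEquiv.funCongrLeft R R e).trans (LinearEquiv.sumArrowLequivProdArrow _ _ R R)⟩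

/-- For `n = p + 1` in characteristic `p`, the differential vanishes on the weights divisible
by `p`. -/
theorem totalBoundary_basis_of_weightDvd {p : ℕ} [CharP R p] (hp0 : 0 < p)
    {S : Finset (UpperIndex (p + 1))} (hS : WeightDvd p S) :
    totalBoundary R (sol R (p + 1)) ((solBasis R (p + 1)).ExteriorAlgebra S) = 0 := by
  refine totalBoundary_basis_eq_zero ?_ fun a => (CharP.intCast_eq_zero_iff R p _).2 (hS a)
  rcases (S.filter fun x => x.row < x.col).eq_empty_or_nonempty with h | h
  · rw [h, basis_exteriorAlgebra_empty, totalBoundary_one]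
  · rw [eq_insert_pathSet_of_weight_dvd hp0 h (fun x hx => (Finset.mem_filter.1 hx).2) hS.filter]
    have hlast : (0 : Fin (p + 1)) < Fin.last p := by simpa [Fin.lt_def] using hp0
    obtain ⟨ε, hε⟩ := pathCycle_eq_smul_basis R hlast.le subset_rfl
    rw [← inv_smul_eq_iff] at hε
    rw [← hε, Units.smul_def, map_zsmul, totalBoundary_pathCycle R hlast subset_rfl, smul_zero]

theorem exists_homotopy_of_charP {p : ℕ} (hp : p.Prime) [CharP R p] (n : ℕ)
    [DecidablePred (WeightDvd (n := n) p)] :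
    ∃ s : ExteriorAlgebra R (sol R n) →ₗ[R] ExteriorAlgebra R (sol R n),
      (∀ k, ∀ z ∈ ⋀[R]^k (sol R n), s z ∈ ⋀[R]^(k + 1) (sol R n)) ∧
      ∀ z, totalBoundary R (sol R n) (s z) + s (totalBoundary R (sol R n) z) =
        z - diagonal (solBasis R n) (fun S => if WeightDvd p S then 1 else 0) z := by
  obtain ⟨s, e, hs, hse⟩ := exists_homotopy R hp n
  refine ⟨s, hs, fun z => ?_⟩
  rw [hse, CharP.cast_eq_zero, zero_smul, add_zero]
  congr!

theorem nonempty_equiv_of_eq_succ {p : ℕ} (hp : p.Prime) [CharP R p] (k : ℕ) :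
    Nonempty (solHomology R (p + 1) k ≃ₗ[R]
      (Fin ((p + 1).choose k) → R) × (Fin (shiftedChoose (p + 1) k (2 * (p + 1) - 3)) → R)) ∧
    Nonempty (solCohomology R (p + 1) k ≃ₗ[R]
      (Fin ((p + 1).choose k) → R) × (Fin (shiftedChoose (p + 1) k (2 * (p + 1) - 3)) → R)) := by
  classical
  obtain ⟨s, hs, hst⟩ := exists_homotopy_of_charP R hp (p + 1)
  obtain ⟨E⟩ := nonempty_fun_equiv_prod R
    (J := {S : Finset (UpperIndex (p + 1)) // S.card = k ∧ WeightDvd p S})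
    ((Fintype.card_subtype _).trans (card_filter_weightDvd hp.pos k))
  have h1 : ∀ S, WeightDvd p S →
      totalBoundary R (sol R (p + 1)) ((solBasis R (p + 1)).ExteriorAlgebra S) = 0 :=
    fun S hS => totalBoundary_basis_of_weightDvd R hp.pos hS
  have h2 : ∀ S, WeightDvd p S → ∀ z, (solBasis R (p + 1)).ExteriorAlgebra.repr
      (totalBoundary R (sol R (p + 1)) z) S = 0 :=
    fun S hS => repr_totalBoundary_eq_zero fun T hT =>
      totalBoundary_basis_of_weightDvd R hp.pos fun a => by rw [hT]; exact hS a
  have h3 := Homology.nonempty_equiv_of_diagonal (solBasis R (p + 1)) E s hs hst h1 h2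
  exact h3

theorem exists_mem_powersetCard_Ioo {n p : ℕ} (hp0 : 0 < p) {i j : Fin n}
    (h : (i : ℕ) + p ≤ j) :
    i < j ∧ ∃ V, V ∈ (Finset.Ioo i j).powersetCard (p - 1) := by
  refine ⟨by rw [Fin.lt_def]; omega, Finset.powersetCard_nonempty.2 ?_⟩
  rw [Fin.card_Ioo]
  omega

theorem add_le_of_mem_powersetCard_Ioo {n p : ℕ} {i j : Fin n} (hij : i < j)
    {V : Finset (Fin n)} (hV : V ∈ (Finset.Ioo i j).powersetCard (p - 1)) :
    (i : ℕ) + p ≤ j := by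
  rw [Finset.mem_powersetCard] at hV
  have := Finset.card_le_card hV.1
  rw [Fin.card_Ioo, hV.2] at this
  rw [Fin.lt_def] at hij
  omega

/-- In degree `2p - 1`, the classes of the wedges of diagonal units and one class of `pathCycle`
for each `(i, j)` with `j - i ≥ p` form a basis of the homology. -/
theorem nonempty_equiv_of_eq_two_mul_sub_one {p : ℕ} (hp : p.Prime) [CharP R p] (n : ℕ) :
    Nonempty (solHomology R n (2 * p - 1) ≃ₗ[R]
      (Fin (n.choose (2 * p - 1)) → R) × (Fin ((n + 1 - p).choose 2) → R)) := by
  classical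
  have hp2 := hp.two_le
  obtain ⟨s, hs, hst⟩ := exists_homotopy_of_charP R hp n
  obtain ⟨E⟩ := nonempty_fun_equiv_prod R
    (J := {S : Finset (UpperIndex n) // S.card = 2 * p - 1 ∧ IsDiag S} ⊕
      {x : Fin n × Fin n // (x.1 : ℕ) + p ≤ x.2}) <| Fintype.card_sum.trans <| congrArg₂ (· + ·)
    ((Fintype.card_subtype _).trans (card_filter_isDiag n (2 * p - 1)))
    ((Fintype.card_subtype _).trans (card_filter_add_le n p))
  have hV : ∀ x : {x : Fin n × Fin n // (x.1 : ℕ) + p ≤ x.2},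
      ∃ V, V ∈ (Finset.Ioo x.1.1 x.1.2).powersetCard (p - 1) := fun x =>
    (exists_mem_powersetCard_Ioo hp.pos x.2).2
  have hlt : ∀ x : {x : Fin n × Fin n // (x.1 : ℕ) + p ≤ x.2}, x.1.1 < x.1.2 := fun x =>
    (exists_mem_powersetCard_Ioo hp.pos x.2).1
  choose V hV using hV
  have hV1 := fun x => (Finset.mem_powersetCard.1 (hV x)).1
  -- the forms of either kind vanish on the cycles of the other kind
  have hdiagform : ∀ S : Finset (UpperIndex n), IsDiag S → ∀ i j : Fin n, i < j →
      pathForm R p i j ((solBasis R n).ExteriorAlgebra S) = 0 := fun S hS i j hij =>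
    pathForm_eq_zero R fun hij' W hW => by
      rw [Basis.repr_self, Finsupp.single_eq_of_ne]
      rintro rfl
      exact hij.ne (hS _ (Finset.mem_insert_self _ _))
  have hcoord : ∀ S : Finset (UpperIndex n), IsDiag S → ∀ x,
      (solBasis R n).ExteriorAlgebra.coord S (pathCycle R x.1.1 x.1.2 (V x)) = 0 := fun S hS x =>
    repr_pathCycle_of_ne R (hlt x).le (hV1 x) fun h =>
      (hlt x).ne (hS (UpperIndex.mk _ _ (hlt x).le) (h.le (Finset.mem_insert_self _ _)))
  refine Homology.nonempty_equiv_of_dual (solBasis R n) E s hs hst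
    (Sum.elim (fun S => (solBasis R n).ExteriorAlgebra S.1)
      fun x => pathCycle R x.1.1 x.1.2 (V x))
    (Sum.elim (fun S => (solBasis R n).ExteriorAlgebra.coord S.1)
      fun x => pathForm R p x.1.1 x.1.2) ?_ ?_ ?_ ?_ ?_ ?_
  · rintro (S | x)
    · have := basis_mem_exteriorPower (solBasis R n) S.1
      rwa [S.2.1] at this
    · have := pathCycle_mem_exteriorPower R (hlt x).le (hV1 x)
      rwa [(Finset.mem_powersetCard.1 (hV x)).2,
        show 2 * (p - 1) + 1 = 2 * p - 1 by omega] at this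
  · rintro (S | x)
    · exact totalBoundary_basis_of_isDiag S.2.2
    · exact totalBoundary_pathCycle R (hlt x) (hV1 x)
  · rintro (S | x) y hy
    · exact repr_totalBoundary_of_isDiag S.2.2 y
    · rw [show 2 * p - 1 + 1 = 2 * p by omega] at hy
      have := dvd_pathForm_totalBoundary R hp2 (hlt x) hy
      rwa [CharP.cast_eq_zero, zero_dvd_iff] at this
  · rintro (S | x) (T | y)
    · rw [Sum.elim_inl, Sum.elim_inl, Basis.coord_apply, Basis.repr_self, Finsupp.single_apply]
      simp only [Sum.inl.injEq, Subtype.ext_iff, eq_comm]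
    · exact (hcoord S.1 S.2.2 y).trans (if_neg Sum.inl_ne_inr).symm
    · exact (hdiagform T.1 T.2.2 _ _ (hlt x)).trans (if_neg Sum.inr_ne_inl).symm
    · by_cases h : x = y
      · subst h
        exact (pathForm_pathCycle_self R (hlt x).le (hV x)).trans (if_pos rfl).symm
      · refine (pathForm_pathCycle_of_ne R hp.pos (hlt y) (hV y) fun h' => h ?_).trans
          (if_neg fun h' => h (Sum.inr_injective h')).symm
        exact Subtype.ext (Prod.ext h'.1.symm h'.2.symm)
  · intro S hS hw
    by_cases hd : IsDiag S
    · rw [Fintype.sum_sum_type, Finset.sum_eq_single_of_mem ⟨S, hS, hd⟩ (Finset.mem_univ _),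
        Finset.sum_eq_zero]
      · simp
      · intro x _
        rw [Sum.elim_inr, hdiagform S hd _ _ (hlt x), zero_smul]
      · intro T _ hT
        have : S ≠ T.1 := fun h => hT (Subtype.ext h.symm)
        simp [this]
    -- the `2p - 1` or more positive roots in `S` exhaust it
    · have hoff : ∀ x ∈ S, x.row < x.col := by
        have h1 := le_card_of_weight_dvd hp.pos (nonempty_of_not_isDiag hd)
          (fun x hx => (Finset.mem_filter.1 hx).2) hw.filter
        have h2 := Finset.eq_of_subset_of_card_le
          (Finset.filter_subset (fun x => x.row < x.col) S) (by omega)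
        intro x hx
        rw [← h2] at hx
        exact (Finset.mem_filter.1 hx).2
      obtain ⟨i, j, hij, W, hW, rfl⟩ := exists_eq_insert_pathSet hp2 hS hoff hw
      have hW1 := (Finset.mem_powersetCard.1 hW).1
      let x₀ : {x : Fin n × Fin n // (x.1 : ℕ) + p ≤ x.2} :=
        ⟨(i, j), add_le_of_mem_powersetCard_Ioo hij hW⟩
      obtain ⟨ε, hε⟩ := pathCycle_eq_smul_basis R hij.le hW1
      rw [← inv_smul_eq_iff] at hε
      rw [Fintype.sum_sum_type, Finset.sum_eq_zero, zero_add,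
        Finset.sum_eq_single_of_mem x₀ (Finset.mem_univ _)]
      · rw [Sum.elim_inr, Sum.elim_inr, ← hε, Units.smul_def, map_zsmul,
          pathForm_pathCycle_self R hij.le hW, smul_assoc, one_smul, ← smul_sub,
          show 2 * p - 1 + 1 = 2 * p by omega]
        exact zsmul_mem (pathCycle_sub_mem R hij hW (hV x₀)) _
      · intro x _ hx
        rw [Sum.elim_inr, ← hε, Units.smul_def, map_zsmul,
          pathForm_pathCycle_of_ne R hp.pos hij hW, smul_zero, zero_smul]
        exact fun h => hx (Subtype.ext (Prod.ext h.1.symm h.2.symm))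
      · rintro T -
        have : insert (UpperIndex.mk i j hij.le) (pathSet i j W) ≠ T.1 := fun h => hd (h ▸ T.2.2)
        simp [this]
  · rintro S hS (T | x)
    · have : S ≠ T.1 := fun h => hS (h ▸ T.2.2.weightDvd p)
      simp [this]
    · refine pathForm_eq_zero R fun hij W hW => ?_
      rw [Basis.repr_self, Finsupp.single_eq_of_ne]
      rintro rfl
      refine hS fun a => ?_
      rw [sum_weight_insert_pathSet hp.pos hij hW]
      simp

end CharP

end ChevalleyEilenberg

theorem proposition3 (p : ℕ) [Fact p.Prime] :
    (∀ (R : Type*) [CommRing R] [CharP R p],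
      (∀ n k : ℕ, n = p + 1 →
        Nonempty (solHomology R n k ≃ₗ[R]
          (Fin (n.choose k) → R) × (Fin (shiftedChoose n k (2 * n - 3)) → R)) ∧
        Nonempty (solCohomology R n k ≃ₗ[R]
          (Fin (n.choose k) → R) × (Fin (shiftedChoose n k (2 * n - 3)) → R))) ∧
      (∀ n k : ℕ, k = 2 * p - 1 →
        Nonempty (solHomology R n k ≃ₗ[R]
          (Fin (n.choose k) → R) × (Fin ((n + 1 - p).choose 2) → R)))) ∧
    IsLeast {n : ℕ | ∃ k : ℕ, HasTorsion p (solHomology ℤ n k)} (p + 1) ∧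
    IsLeast {k : ℕ | ∃ n : ℕ, HasTorsion p (solHomology ℤ n k)} (2 * p - 1) ∧
    IsLeast {n : ℕ | ∃ k : ℕ, HasPrimePowerSummand p (solHomology ℤ n k)} (p + 1) ∧
    IsLeast {k : ℕ | ∃ n : ℕ, HasPrimePowerSummand p (solHomology ℤ n k)} (2 * p - 1) ∧
    HasPrimePowerSummand p (solHomology ℤ (p + 1) (2 * p - 1)) := by
  have hp : p.Prime := Fact.out
  have hsum := ChevalleyEilenberg.hasPrimePowerSummand hp
  have hZ : ∀ r : ℤ, (p : ℤ) * r = 0 → r = 0 := fun r h =>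
    (mul_eq_zero.1 h).resolve_left (Int.natCast_ne_zero.2 hp.ne_zero)
  have hn : ∀ n k, HasTorsion p (solHomology ℤ n k) → p + 1 ≤ n := fun n k h => by
    by_contra hlt
    exact ChevalleyEilenberg.not_hasTorsion ℤ hp hZ
      (fun S _ hS => ChevalleyEilenberg.isDiag_of_le (by omega) hS) h
  have hk : ∀ n k, HasTorsion p (solHomology ℤ n k) → 2 * p - 1 ≤ k := fun n k h => by
    by_contra hlt
    exact ChevalleyEilenberg.not_hasTorsion ℤ hp hZ
      (fun S hc hS => ChevalleyEilenberg.isDiag_of_card_lt hp.pos (by omega) hS) h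
  refine ⟨fun R _ _ => ⟨?_, ?_⟩, ⟨⟨_, hsum.hasTorsion⟩, fun n ⟨k, h⟩ => hn n k h⟩,
    ⟨⟨_, hsum.hasTorsion⟩, fun k ⟨n, h⟩ => hk n k h⟩,
    ⟨⟨_, hsum⟩, fun n ⟨k, h⟩ => hn n k h.hasTorsion⟩,
    ⟨⟨_, hsum⟩, fun k ⟨n, h⟩ => hk n k h.hasTorsion⟩, hsum⟩
  · rintro n k rfl
    exact ChevalleyEilenberg.nonempty_equiv_of_eq_succ R hp k
  · rintro n k rfl
    exact ChevalleyEilenberg.nonempty_equiv_of_eq_two_mul_sub_one R hp n
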